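/- Digraphs are finite, without loops and parallel arcs, but may contain both arcs $xy$ and $yx$. A digraph $D$ is *locally semicomplete* if for every vertex $x$ any two distinct vertices of $N^+(x)$ are joined by at least one arc, and likewise any two distinct vertices of $N^-(x)$. $U(D)$ is the underlying undirected graph of $D$; $D$ is *connected* if $U(D)$ is, and *strong* if every vertex can be reached from every other one by a directed path. The strong components of $D$ are its maximal strong subdigraphs; an *acyclic ordering* of them is an enumeration $C_1,\dots,C_\ell$ with no arc from $C_j$ to $C_i$ for $i<j$. A $(C_1,C_\ell)$-path is a directed path that starts in $C_1$, ends in $C_\ell$ and has no other vertex in $C_1\cup C_\ell$; $d(C_1,C_\ell)$ is the number of arcs of a shortest one. A *Hamilton oriented cycle* $R=v_1v_2\dots v_nv_1$ of $D$ (with $n\ge 3$ vertices) is a spanning subdigraph with exactly $n$ arcs, one between $v_i$ and $v_{i+1}$ for each $i$ (indices modulo $n$); this arc is forward if it goes from $v_i$ to $v_{i+1}$ and backward otherwise. $\sigma^+(R)$ and $\sigma^-(R)$ are the numbers of forward and backward arcs, and $\sigma_{\max}(R)=\max\{\sigma^+(R),\sigma^-(R)\}$. **Theorem.** Let $D$ be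 a connected locally semicomplete digraph on $n\ge 3$ vertices, let $C_1,\dots,C_\ell$ be the acyclic ordering of its strong components, and let $\sigma^{hc}_{\max}$ be the maximum of $\sigma_{\max}(R)$ over all Hamilton oriented cycles $R$ of $D$. - If $D$ is not strong and $U(D)$ is 2-connected, then $D$ has a Hamilton oriented cycle and $\sigma^{hc}_{\max}=n-d(C_1,C_\ell)$. - If $D$ is not strong and $U(D)$ is not 2-connected, then $D$ has no Hamilton oriented cycle. - If $D$ is strong, then $D$ has a Hamilton oriented cycle and $\sigma^{hc}_{\max}=n$. Furthermore, there is an algorithm that, given the adjacency matrix of such a digraph $D$, runs in time polynomial in $n$ and outputs a Hamilton oriented cycle of $D$ with the maximum number of forward arcs, or reports that $D$ has no Hamilton oriented cycle. -/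

import Mathlib

namespace Digraph

variable {V : Type*}

/-- No vertex carries a loop. Parallel arcs do not exist in `Digraph`; both arcs `xy` and `yx` may
be present. -/
def IsLoopless (D : Digraph V) : Prop := ∀ x, ¬ D.Adj x x

/-- The set `S` of vertices induces a semicomplete digraph. -/
def IsSemicompleteOn (D : Digraph V) (S : Set V) : Prop :=
  ∀ x ∈ S, ∀ y ∈ S, x ≠ y → D.Adj x y ∨ D.Adj y x

/-- Out-neighbourhoods and in-neighbourhoods induce semicomplete digraphs. -/
def IsLocallySemicomplete (D : Digraph V) : Prop :=
  ∀ x, D.IsSemicompleteOn {y | D.Adj x y} ∧ D.IsSemicompleteOn {y | D.Adj y x}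

/-- The underlying graph `U(D)`. It is taken without multiplicities of edges: they have no
influence on connectedness and, for at least three vertices, on 2-connectedness. -/
abbrev underlying (D : Digraph V) : SimpleGraph V := D.toSimpleGraphInclusive

/-- A digraph is connected if its underlying graph is. -/
def IsConnected (D : Digraph V) : Prop := D.underlying.Connected

/-- The subdigraph induced by `S` is strong: any vertex of `S` can be reached from any other one
by a directed path inside `S`. -/
def IsStrongOn (D : Digraph V) (S : Set V) : Prop :=
  ∀ x ∈ S, ∀ y ∈ S, Relation.ReflTransGen (fun a b => a ∈ S ∧ b ∈ S ∧ D.Adj a b) x y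

/-- `D` is strong. -/
def IsStrong (D : Digraph V) : Prop := ∀ x y, Relation.ReflTransGen D.Adj x y

/-- `S` is the vertex set of a strong component, i.e. of a maximal strong subdigraph. -/
def IsStrongComponent (D : Digraph V) (S : Set V) : Prop :=
  Maximal (fun S : Set V => S.Nonempty ∧ D.IsStrongOn S) S

/-- `C 0, C 1, …` lists all strong components, each exactly once, and there is no arc from a later
one to an earlier one. -/
structure IsAcyclicOrdering (D : Digraph V) {l : ℕ} (C : Fin l → Set V) : Prop where
  injective : Function.Injective C
  range_eq : Set.range C = {S | D.IsStrongComponent S}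
  no_back_arc : ∀ i j, i < j → ∀ x ∈ C j, ∀ y ∈ C i, ¬ D.Adj x y

/-- A directed `(S, T)`-path with `k` arcs: a directed path that starts in `S`, ends in `T` and has
no other vertex in `S ∪ T`. -/
structure SetPath (D : Digraph V) (S T : Set V) (k : ℕ) where
  vert : Fin (k + 1) → V
  injective : Function.Injective vert
  adj : ∀ i : Fin k, D.Adj (vert i.castSucc) (vert i.succ)
  start_mem : vert 0 ∈ S
  end_mem : vert (Fin.last k) ∈ T
  inner : ∀ i, i ≠ 0 → i ≠ Fin.last k → vert i ∉ S ∪ T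

/-- `d` is the length of a shortest `(S, T)`-path; in particular there is such a path. -/
def IsSetDist (D : Digraph V) (S T : Set V) (d : ℕ) : Prop :=
  IsLeast {k | Nonempty (D.SetPath S T k)} d

/-- A Hamilton oriented cycle `v_0 v_1 … v_{n-1} v_0` of a digraph on `n ≥ 3` vertices: a cyclic
ordering of all the vertices together with, for each `i`, one arc of `D` between `v_i` and its
cyclic successor. This arc goes from `v_i` to the successor if `fwd i` is true, and from the
successor to `v_i` otherwise (where both arcs are present, either may be used). -/
structure HamiltonOrientedCycle (n : ℕ) (D : Digraph V) where
  vert : Fin n ≃ V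
  fwd : Fin n → Bool
  adj_of_fwd : ∀ i, fwd i = true → D.Adj (vert i) (vert (finRotate n i))
  adj_of_bwd : ∀ i, fwd i = false → D.Adj (vert (finRotate n i)) (vert i)

namespace HamiltonOrientedCycle

variable {n : ℕ} {D : Digraph V}

/-- The number of forward arcs. -/
def sigmaPlus (R : HamiltonOrientedCycle n D) : ℕ :=
  (Finset.univ.filter fun i => R.fwd i = true).card

/-- The number of backward arcs. -/
def sigmaMinus (R : HamiltonOrientedCycle n D) : ℕ :=
  (Finset.univ.filter fun i => R.fwd i = false).card

def sigmaMax (R : HamiltonOrientedCycle n D) : ℕ := max R.sigmaPlus R.sigmaMinus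

end HamiltonOrientedCycle

/-- `m` is the maximum of `sigmaMax` over all Hamilton oriented cycles; in particular there is
one. -/
def IsMaxSigma (n : ℕ) (D : Digraph V) (m : ℕ) : Prop :=
  IsGreatest (Set.range fun R : HamiltonOrientedCycle n D => R.sigmaMax) m

end Digraph

/-- `G` is 2-connected: at least three vertices, connected, and no cut vertex. -/
def SimpleGraph.IsTwoConnected {V : Type*} (G : SimpleGraph V) : Prop :=
  3 ≤ Nat.card V ∧ G.Connected ∧ ∀ v : V, (G.induce {v}ᶜ).Connected

/-! A random access machine with programs in structured form. Its memory holds natural numbers in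
scalar variables and in arrays with two indices (unbounded in both). A program is a finite object,
so it mentions finitely many variables and arrays and its expressions have bounded size. There is no
multiplication, so the bit lengths of all numbers grow at most linearly with the number of steps,
and polynomial time on this machine is polynomial time on a Turing machine. -/

namespace RAM

/-- Expressions: constants, variables, array cells, and operations on natural numbers. -/
inductive Expr : Type
  | lit (c : ℕ)
  | var (x : ℕ)
  | get (a : ℕ) (i j : Expr)
  | add (e f : Expr)
  | sub (e f : Expr)
  | eq (e f : Expr)
  | lt (e f : Expr)

/-- Programs: do nothing, assign to a variable, assign to an array cell, composition, branching and
loops; a test succeeds if the value of its expression is not `0`. -/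
inductive Prog : Type
  | skip
  | assign (x : ℕ) (e : Expr)
  | store (a : ℕ) (i j e : Expr)
  | seq (p q : Prog)
  | ite (e : Expr) (p q : Prog)
  | while (e : Expr) (p : Prog)

/-- The memory: `var x` is the value of variable `x`, and `arr a i j` is the content of the cell
`(i, j)` of array `a`. -/
structure Store : Type where
  var : ℕ → ℕ
  arr : ℕ → ℕ → ℕ → ℕ

/-- The value of an expression; subtraction is truncated, comparisons have value `1` or `0`. -/
def Expr.eval (s : Store) : Expr → ℕ
  | lit c => c
  | var x => s.var x
  | get a i j => s.arr a (i.eval s) (j.eval s)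
  | add e f => e.eval s + f.eval s
  | sub e f => e.eval s - f.eval s
  | eq e f => if e.eval s = f.eval s then 1 else 0
  | lt e f => if e.eval s < f.eval s then 1 else 0

def Store.setVar (s : Store) (x v : ℕ) : Store where
  var y := if y = x then v else s.var y
  arr := s.arr

def Store.setArr (s : Store) (a i j v : ℕ) : Store where
  var := s.var
  arr b k l := if b = a ∧ k = i ∧ l = j then v else s.arr b k l

/-- A configuration: the programs that are still to be executed, in this order, and the memory. The
machine has halted when nothing is left to be executed. -/
structure Cfg : Type where
  todo : List Prog
  store : Store

/-- One step of the machine. -/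
def step : Cfg → Cfg
  | ⟨[], s⟩ => ⟨[], s⟩
  | ⟨.skip :: k, s⟩ => ⟨k, s⟩
  | ⟨.assign x e :: k, s⟩ => ⟨k, s.setVar x (e.eval s)⟩
  | ⟨.store a i j e :: k, s⟩ => ⟨k, s.setArr a (i.eval s) (j.eval s) (e.eval s)⟩
  | ⟨.seq p q :: k, s⟩ => ⟨p :: q :: k, s⟩
  | ⟨.ite e p q :: k, s⟩ => if e.eval s ≠ 0 then ⟨p :: k, s⟩ else ⟨q :: k, s⟩
  | ⟨.while e p :: k, s⟩ => if e.eval s ≠ 0 then ⟨p :: .while e p :: k, s⟩ else ⟨k, s⟩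

/-- Started on the memory `s`, the program `p` halts after at most `t` steps with memory `s'`. -/
def HaltsWithin (p : Prog) (s : Store) (t : ℕ) (s' : Store) : Prop :=
  ∃ m ≤ t, step^[m] ⟨[p], s⟩ = ⟨[], s'⟩

open Classical in
/-- The input: variable `0` contains the number `n` of vertices, array `0` contains the adjacency
matrix, and everything else is `0`. -/
noncomputable def input {n : ℕ} (D : Digraph (Fin n)) : Store where
  var x := if x = 0 then n else 0
  arr a u v := if a = 0 ∧ ∃ (hu : u < n) (hv : v < n), D.Adj ⟨u, hu⟩ ⟨v, hv⟩ then 1 else 0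

/-- The memory `s` displays the Hamilton oriented cycle `R`: variable `0` contains `1`, the cells
`(i, 0)` of array `1` contain the vertices in their cyclic order, and the cells `(i, 1)` tell which
arcs are forward (`1`) and which are backward (`0`). -/
def Displays {n : ℕ} {D : Digraph (Fin n)} (s : Store) (R : D.HamiltonOrientedCycle n) : Prop :=
  s.var 0 = 1 ∧
    ∀ i : Fin n, s.arr 1 i 0 = (R.vert i : ℕ) ∧ s.arr 1 i 1 = if R.fwd i = true then 1 else 0

end RAM

/-! In a connected locally semicomplete digraph reachability is total (`reach_total`), so the strong
components are linearly ordered. The basic tool is `adj_of_reach_left`: if `x → y` and `x` reaches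
`v` but `y` does not, then `v → y`; `adj_of_reach_right` is its dual. Take a greedy path from `x₀`
in the first component to `xd` in the last one, each arc of which ends in as late a component as
possible. It has `d = B.length` arcs and is a shortest path between these components
(`IsGreedyPath.isSetDist`).

Upper bound (`sigmaMax_le`): let `g v` be the number of greedy vertices that `v` does not reach.
Along an arc `g` never decreases and grows by at most one; it is `0` at `x₀` and at least `d` at
`xd`. A Hamilton oriented cycle passes through `x₀` and `xd`, hence contains at least `d` arcs of
each direction.

Construction: traverse the greedy path backwards and close it by a directed path from `x₀` to `xd`
through all the other vertices. That some such path or arc exists outside the greedy path is where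
2-connectivity enters (`exists_ear_start`). It is then enlarged: in the non-strong case a single
vertex fits between two consecutive ones (`exists_insert_of_not_strong`); in the strong case `d = 0`
and the directed cycle has an ear between consecutive vertices (`exists_ear_of_strong`). Ears are
inserted one vertex at a time, so at most one forward arc is missing at any moment, and the rest of
the ear guarantees that it can be repaired.

The same construction is the algorithm. It needs only transitive closures and exhaustive search,
written in a language of bounded loops whose running time is polynomial by syntax. A failure is a
correct negative answer, because a Hamilton oriented cycle makes `U(D)` 2-connected and the
construction then succeeds. -/

namespace Digraph

variable {V : Type*} {D : Digraph V}

/-! ### Reachability and ears -/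

/-- `y` can be reached from `x` by a directed path. -/
abbrev Reach (D : Digraph V) : V → V → Prop := Relation.ReflTransGen D.Adj

/-- `y` can be reached from `x` by a directed path that avoids `U` after its first vertex. -/
def AvoidReach (D : Digraph V) (U : Set V) : V → V → Prop :=
  Relation.ReflTransGen fun a b => D.Adj a b ∧ b ∉ U

/-- `w` is the first inner vertex of a path from `x` to `y` all of whose inner vertices lie outside
`U`. -/
def Ear (D : Digraph V) (U : Set V) (x y w : V) : Prop :=
  w ∉ U ∧ D.Adj x w ∧ ∃ z, D.AvoidReach U w z ∧ D.Adj z y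

theorem AvoidReach.reach {U : Set V} {x y : V} (h : D.AvoidReach U x y) : D.Reach x y :=
  Relation.ReflTransGen.mono (fun _ _ h => h.1) _ _ h

/-- Keep only the part of the walk after its last visit to `x`. -/
theorem AvoidReach.insert {U : Set V} {x y : V} (h : D.AvoidReach U x y) :
    D.AvoidReach (insert x U) x y := by
  classical
  induction h with
  | refl => exact .refl
  | @tail b c _ hbc ih =>
    by_cases hc : c = x
    · subst hc; exact .refl
    · exact ih.tail ⟨hbc.1, by simp [hc, hbc.2]⟩

theorem Reach.exists_exit {U : Set V} {x y : V} (h : D.Reach x y) (hx : x ∈ U) (hy : y ∉ U) :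
    ∃ p q, D.Reach x p ∧ p ∈ U ∧ q ∉ U ∧ D.Adj p q ∧ D.Reach q y := by
  induction h with
  | refl => exact absurd hx hy
  | @tail b c hxb hbc ih =>
    by_cases hb : b ∈ U
    · exact ⟨b, c, hxb, hb, hy, hbc, .refl⟩
    · obtain ⟨p, q, h1, h2, h3, h4, h5⟩ := ih hb
      exact ⟨p, q, h1, h2, h3, h4, h5.tail hbc⟩

theorem Reach.exists_entry {U : Set V} {x y : V} (h : D.Reach x y) (hx : x ∉ U) (hy : y ∈ U) :
    ∃ z q, D.AvoidReach U x z ∧ z ∉ U ∧ D.Adj z q ∧ q ∈ U ∧ D.Reach q y := by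
  induction h using Relation.ReflTransGen.head_induction_on with
  | refl => exact absurd hy hx
  | @head a b hab hby ih =>
    by_cases hb : b ∈ U
    · exact ⟨a, b, .refl, hx, hab, hb, hby⟩
    · obtain ⟨z, q, h1, h2, h3, h4, h5⟩ := ih hb
      exact ⟨z, q, .head ⟨hab, hb⟩ h1, h2, h3, h4, h5⟩

/-- Once `w` is on the cycle, what remains of the ear leads from `w` to `y`. This is what keeps the
construction feasible when an ear is inserted vertex by vertex. -/
theorem Ear.insert {U : Set V} {x y w : V} (h : D.Ear U x y w) :
    D.Adj w y ∨ ∃ w', D.Ear (insert w U) w y w' := by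
  obtain ⟨-, -, z, hz, hzy⟩ := h
  rcases Relation.ReflTransGen.cases_head hz.insert with rfl | ⟨w', hw', h⟩
  · exact .inl hzy
  · exact .inr ⟨w', hw'.2, hw'.1, z, h, hzy⟩

namespace IsLocallySemicomplete

/-- Move the tail of the arc along the path from `x` to `v`: the current vertex `u` dominates both
`y` and the next vertex `u'`, so these are joined, and `y → u'` would let `y` reach `v`. -/
theorem adj_of_reach_left (hD : D.IsLocallySemicomplete) {x y v : V} (hxy : D.Adj x y)
    (hxv : D.Reach x v) (hyv : ¬ D.Reach y v) : D.Adj v y := by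
  induction hxv with
  | refl => exact hxy
  | @tail u u' _ huu' ih =>
    have hu := ih fun h => hyv (h.tail huu')
    rcases (hD u).1 y hu u' huu' (by rintro rfl; exact hyv .refl) with h | h
    · exact absurd (.single h) hyv
    · exact h

theorem adj_of_reach_right (hD : D.IsLocallySemicomplete) {x y v : V} (hxy : D.Adj x y)
    (hvy : D.Reach v y) (hvx : ¬ D.Reach v x) : D.Adj x v := by
  induction hvy using Relation.ReflTransGen.head_induction_on with
  | refl => exact hxy
  | @head u' u huu' _ ih =>
    have hu := ih fun h => hvx (h.head huu')
    rcases (hD u).2 x hu u' huu' (by rintro rfl; exact hvx .refl) with h | h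
    · exact h
    · exact absurd (.single h) hvx

/-- Induction along a path of the underlying graph. An edge directed against the known reachability
is either absorbed by it or turned into an arc between `u` and the new vertex by one of the two
preceding lemmas. -/
theorem reach_total (hD : D.IsLocallySemicomplete) (hc : D.IsConnected) (u v : V) :
    D.Reach u v ∨ D.Reach v u := by
  have h := hc.preconnected u v
  rw [SimpleGraph.reachable_iff_reflTransGen] at h
  induction h with
  | refl => exact .inl .refl
  | @tail a b _ hab ih =>
    rcases hab.2 with hab | hab
    · rcases ih with h | h
      · exact .inl (h.tail hab)
      · by_cases hb : D.Reach b u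
        · exact .inr hb
        · exact .inl (.single (hD.adj_of_reach_left hab h hb))
    · rcases ih with h | h
      · by_cases hb : D.Reach u b
        · exact .inl hb
        · exact .inr (.single (hD.adj_of_reach_right hab h hb))
      · exact .inr (h.head hab)

end IsLocallySemicomplete

/-! ### Greedy paths -/

/-- `b` is an out-neighbour of `a` in a later strong component, and in the last one possible. -/
def IsBestOut (D : Digraph V) (a b : V) : Prop :=
  D.Adj a b ∧ ¬ D.Reach b a ∧ ∀ y, D.Adj a y → D.Reach y b

/-- `x₀` is in the first strong component, and the reverse of `B ++ [x₀]` is a path each of whose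
arcs goes as far as possible. -/
structure IsGreedyPath (D : Digraph V) (x₀ : V) (B : List V) : Prop where
  reach : ∀ v, D.Reach x₀ v
  chain : (B ++ [x₀]).IsChain fun b a => D.IsBestOut a b

namespace IsGreedyPath

variable {x₀ : V} {B : List V}

theorem pairwise (h : D.IsGreedyPath x₀ B) :
    (B ++ [x₀]).Pairwise fun b a => D.Reach a b ∧ ¬ D.Reach b a := by
  have : IsTrans V fun b a => D.Reach a b ∧ ¬ D.Reach b a :=
    ⟨fun a b c h1 h2 => ⟨h2.1.trans h1.1, fun h3 => h1.2 (h3.trans h2.1)⟩⟩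
  exact List.isChain_iff_pairwise.1
    (h.chain.imp fun b a hab => ⟨.single hab.1, hab.2.1⟩)

theorem nodup (h : D.IsGreedyPath x₀ B) : (B ++ [x₀]).Nodup :=
  h.pairwise.imp fun {a b} h (e : a = b) => h.2 (e ▸ .refl)

theorem not_reach_first (h : D.IsGreedyPath x₀ B) {b : V} (hb : b ∈ B) : ¬ D.Reach b x₀ :=
  ((List.pairwise_append.1 h.pairwise).2.2 b hb x₀ (by simp)).2

theorem not_last_reach (h : D.IsGreedyPath x₀ B) {xd : V} {T : List V} (hT : B ++ [x₀] = xd :: T)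
    {b : V} (hb : b ∈ B ++ [x₀]) (hne : b ≠ xd) : ¬ D.Reach xd b := by
  have hp := h.pairwise
  rw [hT] at hp hb
  exact ((List.pairwise_cons.1 hp).1 b ((List.mem_cons.1 hb).resolve_left hne)).2

end IsGreedyPath

/-! ### Partial cycles and insertion of vertices -/

/-- The current state of the construction: a cyclic sequence `F ++ B` of vertices, in which `nxt`
gives the successor of each vertex, and each vertex of `F` except for, possibly, `v` has an arc to
its successor. -/
structure IsPartialCycle (D : Digraph V) (x₀ : V) (B F : List V) (nxt : V → V) (v : V) : Prop where
  nodup : (F ++ B).Nodup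
  head : F.head? = some x₀
  mem : v ∈ F
  chain : (F ++ (B ++ [x₀])).IsChain fun a b => nxt a = b
  adj : ∀ x ∈ F, x ≠ v → D.Adj x (nxt x)

theorem forall_mem_of_head {nxt : V → V} {p : V → Prop} {F T : List V} {x₀ xd : V}
    (hc : (F ++ xd :: T).IsChain fun a b => nxt a = b) (hF : F.head? = some x₀) (h₀ : p x₀)
    (hp : ∀ x ∈ F, p x → p (nxt x)) : (∀ x ∈ F, p x) ∧ p xd := by
  induction F generalizing x₀ with
  | nil => simp at hF
  | cons f F ih =>
    obtain rfl : f = x₀ := by simpa using hF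
    have hn := hp f (by simp) h₀
    cases F with
    | nil =>
      have : nxt f = xd := by simpa using hc.rel
      simp [h₀, ← this, hn]
    | cons g F =>
      have hg : nxt f = g := by simpa using hc.rel
      obtain ⟨h1, h2⟩ := ih (x₀ := g) hc.of_cons rfl (hg ▸ hn)
        fun x hx => hp x (List.mem_cons_of_mem _ hx)
      refine ⟨fun x hx => ?_, h2⟩
      rcases List.mem_cons.1 hx with rfl | hx
      exacts [h₀, h1 x hx]

theorem last_of_mem {nxt : V → V} {p : V → Prop} {F T : List V} {a xd : V}
    (hc : (F ++ xd :: T).IsChain fun a b => nxt a = b) (ha : a ∈ F) (h₀ : p a)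
    (hp : ∀ x ∈ F, p x → p (nxt x)) : p xd := by
  induction F with
  | nil => simp at ha
  | cons f F ih =>
    rcases List.mem_cons.1 ha with rfl | ha
    · exact (forall_mem_of_head hc rfl h₀ hp).2
    · exact ih hc.of_cons ha fun x hx => hp x (List.mem_cons_of_mem _ hx)

theorem nxt_mem {nxt : V → V} {F T : List V} (hc : (F ++ T).IsChain fun a b => nxt a = b)
    (hT : T ≠ []) {x : V} (hx : x ∈ F) : nxt x ∈ F ++ T := by
  obtain ⟨A, C, rfl⟩ := List.append_of_mem hx
  obtain ⟨y, R, hy⟩ := List.exists_cons_of_ne_nil (l := C ++ T) (by simp [hT])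
  rw [List.append_assoc, List.cons_append, hy] at hc ⊢
  rw [(List.isChain_append_cons_cons.1 hc).2.1]
  simp

theorem isChain_concat_congr {f g : V → V} {L : List V} {e : V}
    (hc : (L ++ [e]).IsChain fun a b => f a = b) (h : ∀ a ∈ L, g a = f a) :
    (L ++ [e]).IsChain fun a b => g a = b := by
  induction L with
  | nil => simp
  | cons a L ih =>
    have := ih hc.of_cons fun b hb => h b (List.mem_cons_of_mem _ hb)
    cases L with
    | nil => simpa [h a (by simp)] using hc
    | cons b L =>
      simp only [List.cons_append, List.isChain_cons_cons] at hc this ⊢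
      exact ⟨(h a (by simp)).trans hc.1, this⟩

namespace IsPartialCycle

variable {x₀ xd v : V} {B F T : List V} {nxt : V → V}

theorem first_mem (h : D.IsPartialCycle x₀ B F nxt v) : x₀ ∈ F :=
  List.mem_of_mem_head? h.head

theorem nxt_mem (h : D.IsPartialCycle x₀ B F nxt v) {x : V} (hx : x ∈ F) : nxt x ∈ F ++ B := by
  have := Digraph.nxt_mem h.chain (by simp) hx
  have h₀ := h.first_mem
  simp only [List.mem_append, List.mem_singleton] at this ⊢
  rcases this with h | h | h
  exacts [.inl h, .inr h, .inl (h ▸ h₀)]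

theorem last_mem (h : D.IsPartialCycle x₀ B F nxt v) (hT : B ++ [x₀] = xd :: T) :
    xd ∈ F ++ B := by
  have : xd ∈ B ++ [x₀] := by simp [hT]
  have h₀ := h.first_mem
  simp only [List.mem_append, List.mem_singleton] at this ⊢
  rcases this with h | h
  exacts [.inr h, .inl (h ▸ h₀)]

/-- The result of inserting `w` between `x` and its successor. -/
theorem insert [DecidableEq V] (h : D.IsPartialCycle x₀ B F nxt v) {x w : V} (hx : x ∈ F)
    (hw : w ∉ F ++ B) (hxw : D.Adj x w) (hv : D.Adj v (nxt v) ∨ x = v) :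
    ∃ F', F'.Perm (w :: F) ∧
      D.IsPartialCycle x₀ B F' (Function.update (Function.update nxt w (nxt x)) x w) w := by
  obtain ⟨A, C, rfl⟩ := List.append_of_mem hx
  have hp : (A ++ x :: w :: C).Perm (w :: (A ++ x :: C)) := by
    have := List.perm_middle (a := w) (l₁ := A ++ [x]) (l₂ := C)
    simpa using this
  have hxw' : x ≠ w := by rintro rfl; simp at hw
  refine ⟨A ++ x :: w :: C, hp, ?_, ?_, by simp, ?_, ?_⟩
  · rw [(hp.append_right B).nodup_iff, List.cons_append]
    exact List.nodup_cons.2 ⟨hw, h.nodup⟩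
  · have := h.head
    cases A <;> simpa using this
  · obtain ⟨y, R, hy⟩ := List.exists_cons_of_ne_nil (l := C ++ (B ++ [x₀])) (by simp)
    have hc := h.chain
    have hn := h.nodup
    simp only [List.append_assoc, List.cons_append] at hc hn ⊢
    rw [hy] at hc ⊢
    obtain ⟨h1, h2, h3⟩ := List.isChain_append_cons_cons.1 hc
    rw [List.isChain_append_cons_cons, List.isChain_cons_cons]
    refine ⟨isChain_concat_congr h1 fun a ha => ?_, by simp, by simp [hxw'.symm, h2], ?_⟩
    · have : a ≠ x := fun e => (List.nodup_append.1 hn).2.2 a ha x (by simp) e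
      have : a ≠ w := by rintro rfl; simp [ha] at hw
      simp [*]
    · rw [← hy, ← List.append_assoc] at h3 ⊢
      refine isChain_concat_congr h3 fun a ha => ?_
      have : a ≠ x := by
        rintro rfl; exact (List.nodup_cons.1 (List.nodup_append.1 hn).2.1).1 ha
      have : a ≠ w := by
        rintro rfl; simp only [List.mem_append, List.mem_cons] at hw ha; tauto
      simp [*]
  · intro a ha haw
    rcases eq_or_ne a x with rfl | hax
    · simpa using hxw
    · simp only [Function.update_of_ne hax, Function.update_of_ne haw]
      have ha' : a ∈ A ++ x :: C := by
        simp only [List.mem_append, List.mem_cons] at ha ⊢; tauto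
      by_cases hav : a = v
      · subst hav
        rcases hv with hv | hv
        exacts [hv, absurd hv.symm hax]
      · exact h.adj a ha' hav

/-- If an out-neighbour of a vertex of `F` can be inserted nowhere, it is an out-neighbour of the
last vertex. -/
theorem adj_last_of_adj (hD : D.IsLocallySemicomplete) (h : D.IsPartialCycle x₀ B F nxt v)
    (hT : B ++ [x₀] = xd :: T) {a w : V} (ha : a ∈ F) (hw : w ∉ F ++ B) (haw : D.Adj a w)
    (hadj : ∀ x ∈ F, D.Adj x (nxt x)) (hn : ∀ x ∈ F, D.Adj x w → ¬ D.Adj w (nxt x)) :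
    D.Adj xd w := by
  refine last_of_mem (p := fun x => D.Adj x w) (hT ▸ h.chain) ha haw fun x hx hxw => ?_
  rcases (hD x).1 w hxw (nxt x) (hadj x hx) (fun e => hw (e ▸ h.nxt_mem hx)) with h1 | h1
  exacts [absurd h1 (hn x hx hxw), h1]

/-- Dual of `adj_last_of_adj`. Non-adjacency is propagated forwards from `x₀`, since `F` is accessed
from its head. -/
theorem adj_first_of_adj (hD : D.IsLocallySemicomplete) (h : D.IsPartialCycle x₀ B F nxt v)
    (hT : B ++ [x₀] = xd :: T) {a w : V} (ha : a ∈ F ∨ a = xd) (hw : w ∉ F ++ B)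
    (hwa : D.Adj w a) (hadj : ∀ x ∈ F, D.Adj x (nxt x))
    (hn : ∀ x ∈ F, D.Adj w (nxt x) → ¬ D.Adj x w) : D.Adj w x₀ := by
  by_contra h₀
  have := forall_mem_of_head (p := fun x => ¬ D.Adj w x) (hT ▸ h.chain) h.head h₀
    fun x hx hwx hwn => by
      rcases (hD (nxt x)).2 x (hadj x hx) w hwn (fun e => hw (by simp [← e, hx])) with h1 | h1
      exacts [hn x hx hwn h1, hwx h1]
  rcases ha with ha | rfl
  exacts [this.1 a ha hwa, this.2 hwa]

/-- If `D` is not strong, one vertex can be inserted unless the cycle contains all vertices. -/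
theorem exists_insert_of_not_strong (hD : D.IsLocallySemicomplete)
    (hB : D.IsGreedyPath x₀ B) (h : D.IsPartialCycle x₀ B F nxt v) (hT : B ++ [x₀] = xd :: T)
    (hlast : ∀ u, D.Reach u xd) (hs : ¬ D.Reach xd x₀) (hadj : ∀ x ∈ F, D.Adj x (nxt x))
    {u : V} (hu : u ∉ F ++ B) :
    ∃ x ∈ F, ∃ w, w ∉ F ++ B ∧ D.Adj x w ∧ D.Adj w (nxt x) := by
  by_contra! hn
  have hout : ∀ a ∈ F, ∀ w, w ∉ F ++ B → D.Adj a w → D.Adj xd w := fun a ha w hw haw =>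
    h.adj_last_of_adj hD hT ha hw haw hadj fun x hx => hn x hx w hw
  have hin : ∀ a, a ∈ F ∨ a = xd → ∀ w, w ∉ F ++ B → D.Adj w a → D.Adj w x₀ :=
    fun a ha w hw hwa => h.adj_first_of_adj hD hT ha hw hwa hadj
      fun x hx h1 h2 => hn x hx w hw h2 h1
  -- The first component is covered: a path from `x₀` to `u` leaves the cycle at some `p`. If `p ∈
  -- F`, the leaving arc can be moved to `xd`, so `xd` would reach `x₀`; if `p ∈ B`, then `p` itself
  -- would.
  have hfirst : ∀ u, u ∉ F ++ B → ¬ D.Reach u x₀ := by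
    intro u hu hu₀
    obtain ⟨p, q, -, hp, hq, hpq, hqu⟩ := (hB.reach u).exists_exit
      (U := {a | a ∈ F ++ B}) (by simp [h.first_mem]) hu
    rcases List.mem_append.1 hp with hp | hp
    · exact hs ((Relation.ReflTransGen.single (hout p hp q hq hpq)).trans (hqu.trans hu₀))
    · exact hB.not_reach_first hp ((hqu.trans hu₀).head hpq)
  -- If `u` is in the last component, a path from `u` to `xd` enters the cycle in `F` or at `xd`, as
  -- the other vertices of `B` are not reached from `xd`. Moving the entering arc to `x₀`
  -- contradicts `hfirst`.
  by_cases hu' : D.Reach xd u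
  · obtain ⟨p, q, huz, hp, hpq, hq, hqd⟩ := (hlast u).exists_entry
      (U := {a | a ∈ F ++ B}) hu (h.last_mem hT)
    refine hfirst p hp (.single (hin q ?_ p hp hpq))
    rcases List.mem_append.1 hq with hq | hq
    · exact .inl hq
    · by_contra hne
      refine hB.not_last_reach hT (List.mem_append_left _ hq) (fun e => hne (.inr e)) ?_
      exact (hu'.trans huz.reach).tail hpq
  -- Otherwise `u` is overtaken by some forward arc, hence dominates its head and, by `hin`, also
  -- `x₀`.
  · have : ∃ x ∈ F, D.Reach x u ∧ ¬ D.Reach (nxt x) u := by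
      by_contra! hall
      exact hu' (forall_mem_of_head (p := fun x => D.Reach x u) (hT ▸ h.chain) h.head
        (hB.reach u) hall).2
    obtain ⟨x, hx, hxu, hnu⟩ := this
    have hc : ((F ++ [xd]) ++ T).IsChain fun a b => nxt a = b := by
      simpa [hT] using h.chain
    have hm := Digraph.nxt_mem hc.left_of_append (by simp) hx
    exact hfirst u hu (.single (hin (nxt x) (by simpa using hm) u hu
      (hD.adj_of_reach_left (hadj x hx) hxu hnu)))

/-- If `D` is strong, there is an ear unless the cycle contains all vertices. -/
theorem exists_ear_of_strong (hD : D.IsLocallySemicomplete) (hs : D.IsStrong)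
    (h : D.IsPartialCycle x₀ [] F nxt v) (hadj : ∀ x ∈ F, D.Adj x (nxt x))
    {u : V} (hu : u ∉ F) :
    ∃ x ∈ F, ∃ w, D.Ear {a | a ∈ F} x (nxt x) w := by
  by_contra! hn
  have hT : ([] : List V) ++ [x₀] = x₀ :: [] := rfl
  have hn' : ∀ w ∉ F, ∀ x ∈ F, D.Adj x w → ¬ D.Adj w (nxt x) := fun w hw x hx h1 h2 =>
    hn x hx w ⟨hw, h1, w, .refl, h2⟩
  obtain ⟨p, q, -, hp, hq, hpq, hqu⟩ := Reach.exists_exit (U := {a | a ∈ F}) (hs x₀ u)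
    h.first_mem hu
  have h₀q : D.Adj x₀ q := h.adj_last_of_adj hD hT hp (by simpa using hq) hpq hadj
    fun x hx => hn' q hq x hx
  obtain ⟨z, r, hqz, hz, hzr, hr, -⟩ := Reach.exists_entry (U := {a | a ∈ F}) (hs q x₀)
    hq h.first_mem
  have hz₀ : D.Adj z x₀ := h.adj_first_of_adj hD hT (.inl hr) (by simpa using hz) hzr hadj
    fun x hx h1 h2 => hn' z hz x hx h2 h1
  -- The outer path from `q` to `z` would be an ear if `z → nxt x₀`. Starting from this
  -- non-adjacency, go once around the cycle: `z → nxt x` without `z → x` forces `x → z`, so `z`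
  -- would fit after `x`. Back at `x₀` this contradicts `hz₀`.
  refine last_of_mem (p := fun x => ¬ D.Adj z x) (hT ▸ h.chain) (a := nxt x₀)
    (by simpa using h.nxt_mem h.first_mem)
    (fun hz' => hn x₀ h.first_mem q ⟨hq, h₀q, z, hqz, hz'⟩) (fun x hx hzx hzn => ?_) hz₀
  rcases (hD (nxt x)).2 x (hadj x hx) z hzn (fun e => hz (e ▸ hx)) with h1 | h1
  exacts [hn' z hz x hx h1 hzn, hzx h1]

end IsPartialCycle

/-- If the construction is feasible, the arc that is missing can be replaced by a path. -/
def HasArcOrEar (D : Digraph V) (B F : List V) (nxt : V → V) (v : V) : Prop :=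
  D.Adj v (nxt v) ∨ ∃ w, D.Ear {a | a ∈ F ++ B} v (nxt v) w

/-- The vertex `w` may be inserted after the vertex `x`. -/
def CanInsert (D : Digraph V) (B F : List V) (nxt : V → V) (v x w : V) : Prop :=
  x ∈ F ∧ (D.Adj v (nxt v) ∨ x = v) ∧ D.Ear {a | a ∈ F ++ B} x (nxt x) w

namespace IsPartialCycle

variable {x₀ xd v : V} {B F T : List V} {nxt : V → V}

/-- A missing arc is repaired by its ear. If no arc is missing, the two previous existence results
apply; `xd` reaching `x₀` forces `B = []` and makes `D` strong. -/
theorem exists_canInsert (hD : D.IsLocallySemicomplete)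
    (hB : D.IsGreedyPath x₀ B) (h : D.IsPartialCycle x₀ B F nxt v) (hT : B ++ [x₀] = xd :: T)
    (hlast : ∀ u, D.Reach u xd) (he : D.HasArcOrEar B F nxt v) {u : V} (hu : u ∉ F ++ B) :
    ∃ x w, D.CanInsert B F nxt v x w := by
  rcases he with hv | ⟨w, hw⟩
  · have hadj : ∀ x ∈ F, D.Adj x (nxt x) := fun x hx => by
      by_cases hxv : x = v
      exacts [hxv ▸ hv, h.adj x hx hxv]
    by_cases hs : D.Reach xd x₀
    · obtain rfl : B = [] := by
        cases B with
        | nil => rfl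
        | cons b B =>
          obtain ⟨rfl, -⟩ : b = xd ∧ _ := by simpa using hT
          exact absurd hs (hB.not_reach_first (by simp))
      have hs' : D.IsStrong := fun a b => ((hlast a).trans hs).trans (hB.reach b)
      obtain ⟨x, hx, w, hw⟩ := h.exists_ear_of_strong hD hs' hadj (u := u) (by simpa using hu)
      exact ⟨x, w, hx, .inl hv, by simpa using hw⟩
    · obtain ⟨x, hx, w, hw, hxw, hwx⟩ :=
        h.exists_insert_of_not_strong hD hB hT hlast hs hadj hu
      exact ⟨x, w, hx, .inl hv, hw, hxw, w, .refl, hwx⟩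
  · exact ⟨v, w, h.mem, .inr rfl, hw⟩

theorem insert_canInsert [DecidableEq V] (h : D.IsPartialCycle x₀ B F nxt v) {x w : V}
    (hi : D.CanInsert B F nxt v x w) :
    ∃ F', F'.Perm (w :: F) ∧
      D.IsPartialCycle x₀ B F' (Function.update (Function.update nxt w (nxt x)) x w) w ∧
      D.HasArcOrEar B F' (Function.update (Function.update nxt w (nxt x)) x w) w := by
  obtain ⟨hx, hv, he⟩ := hi
  obtain ⟨F', hp, hF'⟩ := h.insert hx he.1 he.2.1 hv
  refine ⟨F', hp, hF', ?_⟩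
  have hxw : w ≠ x := by
    rintro rfl
    exact he.1 (by simp [hx])
  have hU : {a | a ∈ F' ++ B} = Insert.insert w {a | a ∈ F ++ B} := by
    ext a
    simp [hp.mem_iff, or_assoc]
  rw [HasArcOrEar, hU]
  simpa [hxw] using he.insert

end IsPartialCycle

/-! ### Feasibility of the start -/

/-- The state in which the construction starts. -/
theorem isPartialCycle_start {x₀ xd : V} {B T : List V} {nxt : V → V}
    (hB : D.IsGreedyPath x₀ B) (hT : B ++ [x₀] = xd :: T) (h₀ : nxt x₀ = xd)
    (hc : (B ++ [x₀]).IsChain fun a b => nxt a = b) : D.IsPartialCycle x₀ B [x₀] nxt x₀ where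
  nodup := (List.nodup_append_comm (l₁ := B)).1 hB.nodup
  head := rfl
  mem := by simp
  chain := by
    rw [hT] at hc ⊢
    simpa [h₀] using hc
  adj x hx hne := absurd (by simpa using hx) hne

/-- If `U(D)` has no cut vertex, then any vertex is jumped by an arc. -/
theorem exists_adj_jump (h2 : D.underlying.IsTwoConnected) {c p q : V}
    (hp : ¬ D.Reach c p) (hq : D.Reach c q) (hqc : q ≠ c) :
    ∃ p q, D.Adj p q ∧ ¬ D.Reach c p ∧ D.Reach c q ∧ q ≠ c := by
  have hpc : p ≠ c := by rintro rfl; exact hp .refl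
  have h := (h2.2.2 c).preconnected ⟨p, hpc⟩ ⟨q, hqc⟩
  rw [SimpleGraph.reachable_iff_reflTransGen] at h
  by_contra! hn
  suffices ∀ r : ({c}ᶜ : Set V), Relation.ReflTransGen
      (SimpleGraph.induce {c}ᶜ D.underlying).Adj ⟨p, hpc⟩ r → ¬ D.Reach c r from this _ h hq
  intro r hr
  induction hr with
  | refl => exact hp
  | @tail a b _ hab ih =>
    intro hcb
    rcases hab.2 with hab | hab
    · exact b.2 (hn a b hab ih hcb)
    · exact ih (hcb.tail hab)

/-- Suppose that `x₀` cannot get to `xd` off the greedy path, and let `s` be a vertex in the last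
component that it can get to in this way. From `s` every arc to a later component hits the greedy
path. Let `a → c → c'` be the greedy arcs around the place where `s` is overtaken. As `c` is no cut
vertex, `s` also dominates `c'`; as `c'` is no cut vertex, `s` dominates a further greedy vertex in
a place where there is none. -/
theorem exists_ear_start [Finite V] (hD : D.IsLocallySemicomplete) (hc : D.IsConnected)
    (h2 : D.underlying.IsTwoConnected) {x₀ xd : V} {B T : List V} (hB : D.IsGreedyPath x₀ B)
    (hT : B ++ [x₀] = xd :: T) (hlast : ∀ u, D.Reach u xd) (hs : ¬ D.Reach xd x₀) :
    D.Adj x₀ xd ∨ ∃ w, D.Ear {a | a ∈ B ++ [x₀]} x₀ xd w := by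
  by_contra! hn
  set U : Set V := {a | a ∈ B ++ [x₀]} with hU
  -- the vertices that can be reached from `x₀` outside the greedy path
  let S : Set V := {s | D.AvoidReach U x₀ s}
  have hSout : ∀ s ∈ S, ∀ t, D.Adj s t → t ∉ U → t ∈ S := fun s hs t hst ht =>
    Relation.ReflTransGen.tail hs ⟨hst, ht⟩
  have hSU : ∀ s ∈ S, s = x₀ ∨ s ∉ U := fun s hs => by
    rcases Relation.ReflTransGen.cases_tail hs with rfl | ⟨b, -, h⟩
    exacts [.inl rfl, .inr h.2]
  have hSd : ∀ s ∈ S, ¬ D.Adj s xd := fun s hs hsd => by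
    rcases Relation.ReflTransGen.cases_head hs with rfl | ⟨w, hw, h⟩
    · exact hn.1 hsd
    · exact hn.2 w ⟨hw.2, hw.1, s, h, hsd⟩
  obtain ⟨s, hsS, hmax⟩ : ∃ s ∈ S, ∀ t ∈ S, D.Reach s t → D.Reach t s := by
    obtain ⟨s, hs, hmax⟩ := (Set.toFinite S).exists_maximalFor (fun s => {u | D.Reach u s}) S
      ⟨x₀, Relation.ReflTransGen.refl⟩
    exact ⟨s, hs, fun t ht hst => hmax ht (fun u (hu : D.Reach u s) => hu.trans hst)
      Relation.ReflTransGen.refl⟩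
  have hjump : ∀ t, D.Adj s t → ¬ D.Reach t s → t ∈ U := fun t hst hts => by
    by_contra ht
    exact hts (hmax t (hSout s hsS t hst ht) (.single hst))
  -- In the last component the only greedy vertex is `xd`, so a path from `s` to `xd` would complete
  -- an ear.
  have hsd : ¬ D.Reach xd s := fun hds => by
    have hsU : s ∉ U := (hSU s hsS).resolve_left fun e => hs (e ▸ hds)
    obtain ⟨z, q, hsz, -, hzq, hq, -⟩ := (hlast s).exists_entry hsU
      (show xd ∈ U by simp [hU, hT])
    have hqd : q = xd := by
      by_contra hne
      exact hB.not_last_reach hT hq hne ((hds.trans hsz.reach).tail hzq)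
    exact hSd z (Relation.ReflTransGen.trans hsS hsz) (hqd ▸ hzq)
  obtain ⟨A, C, c, a, hsplit, has, hcs⟩ : ∃ A C c a, B ++ [x₀] = A ++ c :: a :: C ∧
      D.Reach a s ∧ ¬ D.Reach c s := by
    by_contra! hno
    have hch : (B ++ [x₀]).IsChain fun c a => D.Reach a s → D.Reach c s :=
      List.isChain_iff_forall_rel_of_append_cons_cons.2 fun c a A C h => hno A C c a h
    have : IsTrans V fun c a => D.Reach a s → D.Reach c s := ⟨fun a b c h1 h2 h => h1 (h2 h)⟩
    have hpw := List.isChain_iff_pairwise.1 hch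
    have hx₀ : x₀ ∈ B ++ [x₀] := by simp
    rw [hT] at hpw hx₀
    rcases List.mem_cons.1 hx₀ with rfl | hx₀
    · exact hs .refl
    · exact hsd ((List.pairwise_cons.1 hpw).1 x₀ hx₀ (hB.reach s))
  have hpw := hB.pairwise
  have hgr := hB.chain
  have hno := hB.nodup
  have hx₀m : x₀ ∈ B ++ [x₀] := by simp
  have hUm : ∀ t, t ∈ U → t ∈ A ++ c :: a :: C := fun t ht => hsplit ▸ ht
  rw [hsplit] at hpw hgr hx₀m hT
  obtain ⟨-, hpc, hAc⟩ := List.pairwise_append.1 hpw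
  have hac : D.IsBestOut a c := (List.isChain_append_cons_cons.1 hgr).2.1
  have hbelow : ∀ t ∈ a :: C, D.Reach t c ∧ ¬ D.Reach c t := (List.pairwise_cons.1 hpc).1
  have hCa : ∀ t ∈ a :: C, D.Reach t a := fun t ht => by
    rcases List.mem_cons.1 ht with rfl | ht
    · exact .refl
    · exact ((List.pairwise_cons.1 (List.pairwise_cons.1 hpc).2).1 t ht).1
  have hsc : D.Adj s c := hD.adj_of_reach_left hac.1 has hcs
  have hcx₀ : ¬ D.Reach c x₀ := fun h => hcs (h.trans (hB.reach s))
  rcases A.eq_nil_or_concat with rfl | ⟨A', c', rfl⟩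
  · obtain ⟨rfl, -⟩ : c = xd ∧ _ := by simpa using hT
    exact hSd s hsS hsc
  simp only [List.concat_eq_append, List.append_assoc, List.cons_append, List.nil_append] at *
  have hcc' : D.IsBestOut c c' := (List.isChain_append_cons_cons.1 hgr).2.1
  obtain ⟨-, hpc', hAc'⟩ := List.pairwise_append.1 hpw
  have hbelow' : ∀ t ∈ c :: a :: C, D.Reach t c' ∧ ¬ D.Reach c' t :=
    (List.pairwise_cons.1 hpc').1
  have habove' : ∀ t ∈ A', D.Reach c' t ∧ ¬ D.Reach t c' := fun t ht =>
    hAc' t ht c' (by simp)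
  have hc's : ¬ D.Reach c' s := fun h => hcs (.head hcc'.1 h)
  -- An arc `p → q` jumps `c`. Its tail reaches `s`, since otherwise `p` would be a greedy vertex
  -- between `a` and `c`. So `s → q`, hence `q` is a greedy vertex beyond `c`, and the tool moves
  -- the head back to `c'`.
  have hsc' : D.Adj s c' := by
    obtain ⟨p, q, hpq, hcp, hcq, hqc⟩ := exists_adj_jump h2 hcx₀ (hlast c)
      (fun e => hSd s hsS (e ▸ hsc))
    have hps : D.Reach p s := by
      by_contra hps
      have hpU := hUm p (hjump p (hD.adj_of_reach_right hsc
        ((hD.reach_total hc p c).resolve_right hcp) hps) hps)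
      simp only [List.mem_append, List.mem_cons] at hpU
      rcases hpU with h | rfl | rfl | h
      · exact hcp (.head hcc'.1 (habove' p h).1)
      · exact hcp (.single hcc'.1)
      · exact hcp .refl
      · exact hps ((hCa p (by simpa using h)).trans has)
    have hqs : ¬ D.Reach q s := fun h => hcs (hcq.trans h)
    have hsq := hD.adj_of_reach_left hpq hps hqs
    have hqU := hUm q (hjump q hsq hqs)
    simp only [List.mem_append, List.mem_cons] at hqU
    refine hD.adj_of_reach_right hsq ?_ hc's
    rcases hqU with h | rfl | rfl | h
    · exact (habove' q h).1
    · exact .refl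
    · exact absurd rfl hqc
    · exact absurd hcq (hbelow q (by simpa using h)).2
  rcases A' with _ | ⟨b, A''⟩
  · obtain ⟨rfl, -⟩ : c' = xd ∧ _ := by simpa using hT
    exact hSd s hsS hsc'
  -- An arc jumping `c'`. If `p` reaches `c`, then `c → q`, so by the greedy choice `q` is a second
  -- greedy vertex in the component of `c'`. If not, `p` is a greedy vertex strictly between `c` and
  -- `c'`.
  obtain ⟨p, q, hpq, hcp, hcq, hqc⟩ := exists_adj_jump h2 (c := c')
    (fun h => hcx₀ (.head hcc'.1 h)) (hlast c') (fun e => hSd s hsS (e ▸ hsc'))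
  by_cases hpc : D.Reach p c
  · have hcq' := hD.adj_of_reach_left hpq hpc fun h => hcc'.2.1 (hcq.trans h)
    have hqc' := hcc'.2.2 q hcq'
    have hqs : ¬ D.Reach q s := fun h => hc's (hcq.trans h)
    have hqU := hUm q (hjump q (hD.adj_of_reach_right hsc' hqc' hqs) hqs)
    rcases List.mem_append.1 hqU with h | h
    · exact (habove' q h).2 hqc'
    · rcases List.mem_cons.1 h with rfl | h
      · exact hqc rfl
      · exact (hbelow' q h).2 hcq
  · have hps : ¬ D.Reach p s := fun h => hpc (h.tail hsc)
    have hpU := hUm p (hjump p (hD.adj_of_reach_right hsc'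
        ((hD.reach_total hc p c').resolve_right hcp) hps) hps)
    rcases List.mem_append.1 hpU with h | h
    · exact hcp (habove' p h).1
    · rcases List.mem_cons.1 h with rfl | h
      · exact hcp .refl
      · rcases List.mem_cons.1 h with rfl | h
        · exact hpc .refl
        · exact hpc (hbelow p h).1

/-- If `D` is strong or `U(D)` is 2-connected, the construction is feasible at the start. -/
theorem hasArcOrEar_start [Finite V] (hn : 3 ≤ Nat.card V) (hD : D.IsLocallySemicomplete)
    (hc : D.IsConnected) (h2 : D.IsStrong ∨ D.underlying.IsTwoConnected) {x₀ xd : V}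
    {B T : List V} {nxt : V → V} (hB : D.IsGreedyPath x₀ B) (hT : B ++ [x₀] = xd :: T)
    (hlast : ∀ u, D.Reach u xd) (h₀ : nxt x₀ = xd) :
    D.HasArcOrEar B [x₀] nxt x₀ := by
  by_cases hs : D.Reach xd x₀
  -- The strong case: `x₀` is its own successor, and the required ear is a closed walk that leaves
  -- `x₀` and returns.
  · obtain ⟨rfl, rfl⟩ : B = [] ∧ xd = x₀ := by
      cases B with
      | nil => exact ⟨rfl, by simpa using (congrArg List.head? hT).symm⟩
      | cons b B =>
        obtain ⟨rfl, -⟩ : b = xd ∧ _ := by simpa using hT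
        exact absurd hs (hB.not_reach_first (by simp))
    have : Nontrivial V := (Finite.one_lt_card_iff_nontrivial).1 (by omega)
    obtain ⟨u, hu⟩ := exists_ne xd
    obtain ⟨p, q, -, rfl, hq, hpq, -⟩ := (hB.reach u).exists_exit (U := {xd}) rfl hu
    obtain ⟨z, r, hqz, -, hzr, rfl, -⟩ := (hlast q).exists_entry (U := {p}) hq rfl
    right
    refine ⟨q, by simpa using hq, hpq, z, ?_, by rw [h₀]; exact hzr⟩
    convert hqz using 1
    ext; simp
  · have hn : ¬ D.IsStrong := fun h => hs (h _ _)
    have := exists_ear_start hD hc (h2.resolve_left hn) hB hT hlast hs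
    rw [HasArcOrEar, h₀]
    convert this using 4
    ext a
    simp [or_comm]

/-! ### Existence of the greedy path and of the cycle -/

/-- The stopping criterion of the greedy path: an arc `p → q` leaving the set of vertices that reach
`a` would give `a → q`, and then `q` reaches `b` and thus `a`. -/
theorem reach_of_forall_out (hD : D.IsLocallySemicomplete) (hc : D.IsConnected) {a b : V}
    (hb : ∀ y, D.Adj a y → D.Reach y b) (hba : D.Reach b a) (u : V) : D.Reach u a := by
  by_contra hu
  obtain ⟨p, q, -, hp, hq, hpq, -⟩ :=
    ((hD.reach_total hc u a).resolve_left hu).exists_exit (U := {v | D.Reach v a}) .refl hu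
  exact hq ((hb q (hD.adj_of_reach_left hpq hp hq)).trans hba)

theorem IsGreedyPath.cons {x₀ xd b : V} {B T : List V} (h : D.IsGreedyPath x₀ B)
    (hT : B ++ [x₀] = xd :: T) (hb : D.IsBestOut xd b) : D.IsGreedyPath x₀ (b :: B) where
  reach := h.reach
  chain := by
    have := h.chain
    rw [List.cons_append, hT] at *
    exact List.isChain_cons_cons.2 ⟨hb, this⟩

theorem isGreedyPath_nil {x₀ : V} (h : ∀ v, D.Reach x₀ v) : D.IsGreedyPath x₀ [] :=
  ⟨h, by simp⟩

theorem IsGreedyPath.length_lt [Fintype V] {x₀ : V} {B : List V} (h : D.IsGreedyPath x₀ B) :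
    B.length < Fintype.card V := by
  have := h.nodup.length_le_card
  simpa using this

theorem exists_reach_all [Finite V] [Nonempty V] (hD : D.IsLocallySemicomplete)
    (hc : D.IsConnected) : ∃ x₀, ∀ v, D.Reach x₀ v := by
  obtain ⟨s, -, hmax⟩ := (Set.toFinite (Set.univ : Set V)).exists_maximalFor
    (fun s => {u | D.Reach s u}) Set.univ Set.univ_nonempty
  refine ⟨s, fun v => (hD.reach_total hc s v).elim id fun hvs => ?_⟩
  exact hmax (Set.mem_univ v) (fun u (hu : D.Reach s u) => hvs.trans hu)
    (show D.Reach v v from .refl)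

theorem exists_max_out [Finite V] (hD : D.IsLocallySemicomplete) (hc : D.IsConnected) (a : V) :
    ∃ b, (D.Adj a b ∨ b = a) ∧ ∀ y, D.Adj a y → D.Reach y b := by
  obtain ⟨s, hs, hmax⟩ := (Set.toFinite {b | D.Adj a b ∨ b = a}).exists_maximalFor
    (fun s => {u | D.Reach u s}) _ ⟨a, .inr rfl⟩
  refine ⟨s, hs, fun y hy => (hD.reach_total hc y s).elim id fun hsy => ?_⟩
  exact hmax (.inl hy) (fun u (hu : D.Reach u s) => hu.trans hsy) (show D.Reach y y from .refl)

theorem exists_isGreedyPath [Finite V] [Nonempty V] (hD : D.IsLocallySemicomplete)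
    (hc : D.IsConnected) : ∃ (x₀ xd : V) (B T : List V), D.IsGreedyPath x₀ B ∧
      B ++ [x₀] = xd :: T ∧ ∀ u, D.Reach u xd := by
  obtain ⟨x₀, hx₀⟩ := exists_reach_all hD hc
  -- After `k` rounds the path is finished or has `k` arcs; the latter is impossible for `k =
  -- Fintype.card V`.
  have key : ∀ k : ℕ, ∃ (xd : V) (B T : List V), D.IsGreedyPath x₀ B ∧
      B ++ [x₀] = xd :: T ∧ ((∀ u, D.Reach u xd) ∨ B.length = k) := by
    intro k
    induction k with
    | zero => exact ⟨x₀, [], [], isGreedyPath_nil hx₀, rfl, .inr rfl⟩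
    | succ k ih =>
      obtain ⟨xd, B, T, hB, hT, h | h⟩ := ih
      · exact ⟨xd, B, T, hB, hT, .inl h⟩
      · obtain ⟨b, hb, hmax⟩ := exists_max_out hD hc xd
        by_cases hbd : D.Reach b xd
        · exact ⟨xd, B, T, hB, hT, .inl (reach_of_forall_out hD hc hmax hbd)⟩
        · have hb' := hb.resolve_right fun e => hbd (e ▸ .refl)
          exact ⟨b, b :: B, xd :: T, hB.cons hT ⟨hb', hbd, hmax⟩, by simp [hT], .inr (by simp [h])⟩
  have := Fintype.ofFinite V
  obtain ⟨xd, B, T, hB, hT, h | h⟩ := key (Fintype.card V)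
  · exact ⟨x₀, xd, B, T, hB, hT, h⟩
  · exact absurd hB.length_lt (by omega)

theorem exists_isChain_eq [DecidableEq V] {L : List V} {e : V} (h : (L ++ [e]).Nodup) :
    ∃ f : V → V, (L ++ [e]).IsChain fun a b => f a = b := by
  induction L with
  | nil => exact ⟨id, by simp⟩
  | cons a L ih =>
    obtain ⟨ha, hL⟩ := List.nodup_cons.1 h
    obtain ⟨f, hf⟩ := ih hL
    obtain ⟨b, R, hb⟩ := List.exists_cons_of_ne_nil (l := L ++ [e]) (by simp)
    refine ⟨Function.update f a b, ?_⟩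
    have := isChain_concat_congr (g := Function.update f a b) hf fun c hc => by
      rw [Function.update_of_ne]
      rintro rfl
      exact ha (by simp [hc])
    rw [List.cons_append]
    rw [hb] at this ⊢
    exact List.isChain_cons_cons.2 ⟨by simp, this⟩

theorem exists_isPartialCycle_start [DecidableEq V] {x₀ xd : V} {B T : List V}
    (hB : D.IsGreedyPath x₀ B) (hT : B ++ [x₀] = xd :: T) :
    ∃ nxt, nxt x₀ = xd ∧ D.IsPartialCycle x₀ B [x₀] nxt x₀ := by
  obtain ⟨f, hf⟩ := exists_isChain_eq hB.nodup
  refine ⟨Function.update f x₀ xd, by simp, isPartialCycle_start hB hT (by simp) ?_⟩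
  refine isChain_concat_congr hf fun a ha => ?_
  rw [Function.update_of_ne]
  rintro rfl
  exact hB.not_reach_first ha .refl

theorem exists_isPartialCycle_full [Fintype V] (hn : 3 ≤ Fintype.card V)
    (hD : D.IsLocallySemicomplete)
    (hc : D.IsConnected) (h2 : D.IsStrong ∨ D.underlying.IsTwoConnected) {x₀ xd : V}
    {B T : List V} (hB : D.IsGreedyPath x₀ B) (hT : B ++ [x₀] = xd :: T)
    (hlast : ∀ u, D.Reach u xd) :
    ∃ F nxt v, D.IsPartialCycle x₀ B F nxt v ∧ (∀ u, u ∈ F ++ B) ∧ D.Adj v (nxt v) := by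
  classical
  -- Each round adds one vertex to `F`. When all vertices are covered there is no room for an ear,
  -- so feasibility means that no arc is missing.
  have key : ∀ k : ℕ, ∃ F nxt v, D.IsPartialCycle x₀ B F nxt v ∧ D.HasArcOrEar B F nxt v ∧
      ((∀ u, u ∈ F ++ B) ∨ F.length = k + 1) := by
    intro k
    induction k with
    | zero =>
      obtain ⟨nxt, h₀, h⟩ := exists_isPartialCycle_start hB hT
      exact ⟨[x₀], nxt, x₀, h, hasArcOrEar_start (by simpa using hn) hD hc h2 hB hT hlast h₀,
        .inr rfl⟩
    | succ k ih =>
      obtain ⟨F, nxt, v, h, he, hk⟩ := ih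
      by_cases hall : ∀ u, u ∈ F ++ B
      · exact ⟨F, nxt, v, h, he, .inl hall⟩
      · push Not at hall
        obtain ⟨u, hu⟩ := hall
        obtain ⟨x, w, hi⟩ := h.exists_canInsert hD hB hT hlast he hu
        obtain ⟨F', hp, h', he'⟩ := h.insert_canInsert hi
        refine ⟨F', _, w, h', he', .inr ?_⟩
        simp [hp.length_eq, hk.resolve_left fun hall => hu (hall u)]
  obtain ⟨F, nxt, v, h, he, hk⟩ := key (Fintype.card V)
  have hall : ∀ u, u ∈ F ++ B := by
    refine hk.resolve_right fun hk => ?_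
    have := h.nodup.length_le_card
    simp only [List.length_append] at this
    omega
  refine ⟨F, nxt, v, h, hall, he.resolve_right ?_⟩
  rintro ⟨w, hw⟩
  exact hw.1 (hall w)

/-! ### Reading off the Hamilton oriented cycle -/

theorem IsGreedyPath.adj_nxt {x₀ : V} {B : List V} {nxt : V → V} (hB : D.IsGreedyPath x₀ B)
    (hc : (B ++ [x₀]).IsChain fun a b => nxt a = b) {b : V} (hb : b ∈ B) :
    D.Adj (nxt b) b := by
  obtain ⟨A, C, rfl⟩ := List.append_of_mem hb
  obtain ⟨y, R, hy⟩ := List.exists_cons_of_ne_nil (l := C ++ [x₀]) (by simp)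
  have hg := hB.chain
  rw [List.append_assoc, List.cons_append, hy] at hc hg
  rw [(List.isChain_append_cons_cons.1 hc).2.1]
  exact (List.isChain_append_cons_cons.1 hg).2.1.1

namespace IsPartialCycle

variable {x₀ v : V} {B F : List V} {nxt : V → V}

theorem length_eq [Fintype V] (h : D.IsPartialCycle x₀ B F nxt v) (hall : ∀ u, u ∈ F ++ B) :
    (F ++ B).length = Fintype.card V := by
  classical
  rw [← List.toFinset_card_of_nodup h.nodup, ← Finset.card_univ]
  congr 1
  ext u
  simpa using hall u

theorem getElem_zero (h : D.IsPartialCycle x₀ B F nxt v) (h₀ : 0 < (F ++ B).length) :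
    (F ++ B)[0] = x₀ := by
  have := h.head
  cases F with
  | nil => simp at this
  | cons a F => simpa using this

theorem getElem_succ (h : D.IsPartialCycle x₀ B F nxt v) {i : ℕ} (hi : i + 1 < (F ++ B).length) :
    (F ++ B)[i + 1] = nxt (F ++ B)[i] := by
  have := (List.isChain_iff_getElem.1 h.chain) i (by simp at hi ⊢; omega)
  simp only [← List.append_assoc F] at this
  rw [List.getElem_append_left (as := F ++ B) (by omega),
    List.getElem_append_left (as := F ++ B) (by omega)] at this
  exact this.symm

theorem nxt_getLast (h : D.IsPartialCycle x₀ B F nxt v) {i : ℕ} (hi : i + 1 = (F ++ B).length) :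
    nxt (F ++ B)[i] = x₀ := by
  have := (List.isChain_iff_getElem.1 h.chain) i (by simp at hi ⊢; omega)
  simp only [← List.append_assoc F] at this
  rw [List.getElem_append_left (as := F ++ B) (by omega),
    List.getElem_append_right (as := F ++ B) (by omega)] at this
  simpa using this

theorem getElem_eq_iterate (h : D.IsPartialCycle x₀ B F nxt v) {i : ℕ}
    (hi : i < (F ++ B).length) : (F ++ B)[i] = nxt^[i] x₀ := by
  induction i with
  | zero => exact h.getElem_zero hi
  | succ i ih => rw [h.getElem_succ hi, ih (by omega), Function.iterate_succ_apply']

theorem exists_hamiltonOrientedCycle [Fintype V] {n : ℕ} (hn : Fintype.card V = n)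
    (hB : D.IsGreedyPath x₀ B) (h : D.IsPartialCycle x₀ B F nxt v) (hall : ∀ u, u ∈ F ++ B)
    (hv : D.Adj v (nxt v)) :
    ∃ R : D.HamiltonOrientedCycle n, R.sigmaPlus = n - B.length ∧
      ∀ i : Fin n, R.vert i = nxt^[i] x₀ ∧ (R.fwd i = true ↔ (i : ℕ) < n - B.length) := by
  have hl := (h.length_eq hall).trans hn
  have hFB : F.length = n - B.length := by simp at hl; omega
  let f : Fin n → V := fun i => (F ++ B)[(i : ℕ)]'(by omega)
  have hf : Function.Bijective f := by
    rw [Fintype.bijective_iff_injective_and_card]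
    refine ⟨fun i j hij => Fin.ext ?_, by simp [hn]⟩
    exact (List.Nodup.getElem_inj_iff h.nodup).1 hij
  have hrot : ∀ i, f (finRotate n i) = nxt (f i) := by
    cases n with
    | zero => exact fun i => i.elim0
    | succ n =>
      intro i
      by_cases hi : i = Fin.last n
      · subst hi
        rw [finRotate_last]
        exact (h.getElem_zero (by omega)).trans (h.nxt_getLast (by rw [hl, Fin.val_last])).symm
      · have hi' := coe_finRotate_of_ne_last hi
        simp only [f, hi']
        exact h.getElem_succ _
  have hadj : ∀ x ∈ F, D.Adj x (nxt x) := fun x hx => by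
    by_cases hxv : x = v
    exacts [hxv ▸ hv, h.adj x hx hxv]
  let R : D.HamiltonOrientedCycle n :=
    { vert := Equiv.ofBijective f hf
      fwd := fun i => decide ((i : ℕ) < n - B.length)
      adj_of_fwd := fun i hi => by
        have hi : (i : ℕ) < F.length := by simpa [hFB] using hi
        simp only [Equiv.ofBijective_apply, hrot]
        exact hadj _ (by simp [f, List.getElem_append_left hi])
      adj_of_bwd := fun i hi => by
        have hi : F.length ≤ (i : ℕ) := by simpa [hFB] using hi
        simp only [Equiv.ofBijective_apply, hrot]
        exact hB.adj_nxt h.chain.right_of_append (by simp [f, List.getElem_append_right hi]) }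
  refine ⟨R, ?_, fun i => ⟨?_, by simp [R]⟩⟩
  · simp only [HamiltonOrientedCycle.sigmaPlus, R, decide_eq_true_eq]
    rw [Fin.card_filter_val_lt]
    omega
  · exact h.getElem_eq_iterate _

end IsPartialCycle

/-! ### The upper bound -/

open scoped Fin.NatCast Fin.CommRing in
theorem forall_of_finRotate {n : ℕ} {p : Fin n → Prop} (h : ∀ i, p i → p (finRotate n i))
    {i : Fin n} (hi : p i) (j : Fin n) : p j := by
  have := i.neZero
  have key : ∀ k : ℕ, p (i + (k : Fin n)) := by
    intro k
    induction k with
    | zero => simpa using hi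
    | succ k ih =>
      have := h _ ih
      rwa [finRotate_apply, add_assoc, ← Nat.cast_succ] at this
  simpa using key (j - i : Fin n).val

/-- Going around from `i` to `j`, each level `t` with `g j ≤ t < g i` is crossed downwards at some
`m`. Drops are at most one and happen only where `b` holds, so `g m = t + 1`, and `m ↦ g m - 1`
covers all the levels. -/
theorem le_add_card_of_finRotate {n : ℕ} (g : Fin n → ℕ) (b : Fin n → Prop) [DecidablePred b]
    (h : ∀ i, g i ≤ g (finRotate n i) + if b i then 1 else 0) (i j : Fin n) :
    g i ≤ g j + (Finset.univ.filter b).card := by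
  have hsub : Finset.Ico (g j) (g i) ⊆ (Finset.univ.filter b).image fun m => g m - 1 := by
    intro t ht
    rw [Finset.mem_Ico] at ht
    obtain ⟨m, hm, hm'⟩ : ∃ m, t < g m ∧ g (finRotate n m) ≤ t := by
      by_contra! hno
      exact absurd (forall_of_finRotate (p := fun m => t < g m) hno ht.2 j) (by omega)
    have := h m
    simp only [Finset.mem_image, Finset.mem_filter, Finset.mem_univ, true_and]
    refine ⟨m, ?_, ?_⟩
    · by_contra hb
      rw [if_neg hb] at this
      omega
    · split_ifs at this <;> omega
  have := (Finset.card_le_card hsub).trans Finset.card_image_le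
  rw [Nat.card_Ico] at this
  omega

theorem countP_cons_le_of_isChain {α : Type*} {p q : α → Bool} {b : α} {L : List α}
    (h : (b :: L).IsChain fun b a => p b = true → q a = true) :
    (b :: L).countP p ≤ L.countP q + 1 := by
  induction L generalizing b with
  | nil => simp [List.countP_cons]; split_ifs <;> omega
  | cons a L ih =>
    obtain ⟨h1, h2⟩ := List.isChain_cons_cons.1 h
    have := ih h2
    rw [List.countP_cons, List.countP_cons (p := q)]
    by_cases hb : p b
    · simp [hb, h1 hb]; omega
    · simp [hb]; omega

open Classical in
/-- The distance from the first strong component, read off from a greedy path. -/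
noncomputable def greedyDist (D : Digraph V) (T : List V) (v : V) : ℕ :=
  T.countP fun x => decide (¬ D.Reach v x)

theorem greedyDist_mono {T : List V} {x y : V} (h : D.Reach x y) :
    D.greedyDist T x ≤ D.greedyDist T y :=
  List.countP_mono_left fun a _ ha => by
    simp only [decide_eq_true_eq] at ha ⊢
    exact fun hy => ha (h.trans hy)

namespace IsGreedyPath

variable {x₀ xd : V} {B T : List V}

/-- Shift by one along the path: if `y` misses `b`, then `x` misses its greedy predecessor `a`.
Otherwise `a → y`, and `y` reaches `b` by the greedy choice. Only `x₀` has no predecessor, which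
accounts for the `1`. -/
theorem greedyDist_le (hD : D.IsLocallySemicomplete) (hB : D.IsGreedyPath x₀ B) {x y : V}
    (hxy : D.Adj x y) :
    D.greedyDist (B ++ [x₀]) y ≤ D.greedyDist (B ++ [x₀]) x + 1 := by
  classical
  obtain ⟨b, L, hb⟩ := List.exists_cons_of_ne_nil (l := B ++ [x₀]) (by simp)
  have hc := hB.chain
  rw [hb] at hc ⊢
  refine (countP_cons_le_of_isChain (L := L) (q := fun a => decide (¬ D.Reach x a)) ?_).trans ?_
  · refine hc.imp fun b a hab => ?_
    simp only [decide_eq_true_eq]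
    refine mt fun hxa => ?_
    by_contra hyb
    exact hyb (hab.2.2 y (hD.adj_of_reach_left hxy hxa fun h => hyb (h.tail hab.1)))
  · exact Nat.add_le_add_right ((List.sublist_cons_self b L).countP_le) 1

theorem greedyDist_first (hB : D.IsGreedyPath x₀ B) {v : V} (hv : D.Reach v x₀) :
    D.greedyDist (B ++ [x₀]) v = 0 := by
  rw [greedyDist, List.countP_eq_zero]
  intro a _
  simpa using hv.trans (hB.reach a)

theorem greedyDist_last (hB : D.IsGreedyPath x₀ B) (hT : B ++ [x₀] = xd :: T) {v : V}
    (hv : D.Reach xd v) : B.length ≤ D.greedyDist (B ++ [x₀]) v := by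
  refine le_trans ?_ (greedyDist_mono hv)
  have hl : B.length = T.length := by simpa using congrArg List.length hT
  have hno := hB.nodup
  rw [greedyDist, hT, hl]
  refine le_trans (le_of_eq ?_) ((List.sublist_cons_self xd T).countP_le)
  symm
  rw [List.countP_eq_length]
  intro a ha
  rw [hT] at hno
  simp only [decide_eq_true_eq]
  refine hB.not_last_reach hT (by simp [hT, ha]) ?_
  rintro rfl
  exact (List.nodup_cons.1 hno).1 ha

end IsGreedyPath

namespace HamiltonOrientedCycle

variable {n : ℕ}

theorem sigmaPlus_add_sigmaMinus (R : D.HamiltonOrientedCycle n) :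
    R.sigmaPlus + R.sigmaMinus = n := by
  have := Finset.card_filter_add_card_filter_not (s := (Finset.univ : Finset (Fin n)))
    (fun i => R.fwd i = true)
  simpa [sigmaPlus, sigmaMinus] using this

theorem sigmaMax_le (hD : D.IsLocallySemicomplete) {x₀ : V} {B : List V}
    (hB : D.IsGreedyPath x₀ B) (R : D.HamiltonOrientedCycle n) :
    R.sigmaMax ≤ n - B.length := by
  obtain ⟨xd, T, hT⟩ := List.exists_cons_of_ne_nil (l := B ++ [x₀]) (by simp)
  let g : Fin n → ℕ := fun i => D.greedyDist (B ++ [x₀]) (R.vert i)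
  have hfirst : g (R.vert.symm x₀) = 0 := by simp [g, hB.greedyDist_first .refl]
  have hlast : B.length ≤ g (R.vert.symm xd) := by simp [g, hB.greedyDist_last hT .refl]
  have h1 := le_add_card_of_finRotate g (fun i => R.fwd i = false) (fun i => by
    cases hi : R.fwd i
    · simpa using hB.greedyDist_le hD (R.adj_of_bwd i hi)
    · simpa using greedyDist_mono (.single (R.adj_of_fwd i hi)))
    (R.vert.symm xd) (R.vert.symm x₀)
  have hle : ∀ i, g i ≤ ∑ j, g j := fun i =>
    Finset.single_le_sum (f := g) (fun _ _ => Nat.zero_le _) (Finset.mem_univ i)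
  -- The same count for ascents; the sum is just a common upper bound that turns them into descents
  -- without truncation.
  have h2 := le_add_card_of_finRotate (fun i => (∑ j, g j) - g i) (fun i => R.fwd i = true)
    (fun i => by
      have h3 := hle i
      have h4 := hle (finRotate n i)
      cases hi : R.fwd i
      · have : g (finRotate n i) ≤ g i := greedyDist_mono (.single (R.adj_of_bwd i hi))
        simp only [Bool.false_eq_true, if_false]; omega
      · have : g (finRotate n i) ≤ g i + 1 := hB.greedyDist_le hD (R.adj_of_fwd i hi)
        simp only [if_true]; omega)
    (R.vert.symm x₀) (R.vert.symm xd)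
  have h3 := hle (R.vert.symm xd)
  have h4 := R.sigmaPlus_add_sigmaMinus
  change _ ≤ _ + R.sigmaMinus at h1
  change _ ≤ _ + R.sigmaPlus at h2
  simp only [hfirst] at h1 h2
  rw [sigmaMax]
  omega

/-- A cycle minus a vertex is a path. The induction over the rotation starts at the deleted vertex
itself, where the claim is vacuous. -/
theorem underlying_isTwoConnected [Finite V] (hn : 3 ≤ n) (hV : Nat.card V = n)
    (hc : D.IsConnected) (R : D.HamiltonOrientedCycle n) : D.underlying.IsTwoConnected := by
  have hrot : ∀ i, finRotate n i ≠ i := fun i => by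
    have : i ∈ (finRotate n).support := by simp [support_finRotate_of_le (by omega : 2 ≤ n)]
    simpa using this
  refine ⟨by omega, hc, fun v => ?_⟩
  obtain ⟨i, rfl⟩ := R.vert.surjective v
  have hs : R.vert (finRotate n i) ∈ ({R.vert i}ᶜ : Set V) := by simpa using hrot i
  have key := forall_of_finRotate (i := i) (p := fun j => ∀ hj : R.vert j ∈ ({R.vert i}ᶜ : Set V),
    (SimpleGraph.induce {R.vert i}ᶜ D.underlying).Reachable ⟨_, hs⟩ ⟨_, hj⟩) (fun j ih hj => by
      by_cases hij : j = i
      · subst hij; exact .refl _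
      · have hj' : R.vert j ∈ ({R.vert i}ᶜ : Set V) := by simpa using hij
        refine (ih hj').trans (SimpleGraph.Adj.reachable ?_)
        refine (SimpleGraph.fromRel_adj _ _ _).2 ⟨by simpa using (hrot j).symm, ?_⟩
        cases hf : R.fwd j
        exacts [.inr (R.adj_of_bwd j hf), .inl (R.adj_of_fwd j hf)]) (fun hi => absurd rfl hi)
  have : Nonempty ({R.vert i}ᶜ : Set V) := ⟨⟨_, hs⟩⟩
  refine ⟨fun a b => ?_⟩
  have h : ∀ a : ({R.vert i}ᶜ : Set V),
      (SimpleGraph.induce {R.vert i}ᶜ D.underlying).Reachable ⟨_, hs⟩ a := by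
    rintro ⟨a, ha⟩
    obtain ⟨j, rfl⟩ := R.vert.surjective a
    exact key j ha
  exact (h a).symm.trans (h b)

end HamiltonOrientedCycle

/-! ### Strong components -/

theorem isStrongComponent_setOf (x : V) :
    D.IsStrongComponent {y | D.Reach x y ∧ D.Reach y x} := by
  refine ⟨⟨⟨x, .refl, .refl⟩, fun a ha b hb => ?_⟩, fun S hS hle y hy => ?_⟩
  · have hab : D.Reach a b := ha.2.trans hb.1
    induction hab with
    | refl => exact .refl
    | @tail b c hab hbc ih =>
      have hb' : D.Reach x b ∧ D.Reach b x := ⟨ha.1.trans hab, .head hbc hb.2⟩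
      exact (ih hb').tail ⟨hb', hb, hbc⟩
  · have hx : x ∈ S := hle ⟨.refl, .refl⟩
    have mono : ∀ a b, Relation.ReflTransGen (fun a b => a ∈ S ∧ b ∈ S ∧ D.Adj a b) a b →
        D.Reach a b := fun a b => Relation.ReflTransGen.mono (fun _ _ h => h.2.2) a b
    exact ⟨mono _ _ (hS.2 x hx y hy), mono _ _ (hS.2 y hy x hx)⟩

theorem IsStrongComponent.eq_setOf {S : Set V} (hS : D.IsStrongComponent S) {x : V} (hx : x ∈ S) :
    S = {y | D.Reach x y ∧ D.Reach y x} := by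
  have mono : ∀ a b, Relation.ReflTransGen (fun a b => a ∈ S ∧ b ∈ S ∧ D.Adj a b) a b →
      D.Reach a b := fun a b => Relation.ReflTransGen.mono (fun _ _ h => h.2.2) a b
  have hle : S ≤ {y | D.Reach x y ∧ D.Reach y x} := fun y hy =>
    ⟨mono _ _ (hS.1.2 x hx y hy), mono _ _ (hS.1.2 y hy x hx)⟩
  exact le_antisymm hle (hS.2 (isStrongComponent_setOf x).1 hle)

namespace IsAcyclicOrdering

variable {l : ℕ}

theorem exists_mem {C : Fin l → Set V} (hC : D.IsAcyclicOrdering C) (x : V) :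
    ∃ i, C i = {y | D.Reach x y ∧ D.Reach y x} := by
  have : {y | D.Reach x y ∧ D.Reach y x} ∈ Set.range C := by
    rw [hC.range_eq]
    exact isStrongComponent_setOf x
  exact this

theorem isStrongComponent {C : Fin l → Set V} (hC : D.IsAcyclicOrdering C) (i : Fin l) :
    D.IsStrongComponent (C i) := by
  have : C i ∈ Set.range C := ⟨i, rfl⟩
  rwa [hC.range_eq] at this

theorem le_of_reach {C : Fin l → Set V} (hC : D.IsAcyclicOrdering C) {x y : V} {i j : Fin l}
    (hxy : D.Reach x y) (hx : x ∈ C i) (hy : y ∈ C j) : i ≤ j := by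
  induction hxy generalizing j with
  | refl =>
    refine le_of_eq (hC.injective ?_)
    rw [(hC.isStrongComponent i).eq_setOf hx, (hC.isStrongComponent j).eq_setOf hy]
  | @tail b c _ hbc ih =>
    obtain ⟨m, hm⟩ := hC.exists_mem b
    have hb : b ∈ C m := hm ▸ ⟨.refl, .refl⟩
    refine (ih hb).trans (not_lt.1 fun hjm => ?_)
    exact hC.no_back_arc j m hjm b hb c hy hbc

theorem first_eq {C : Fin (l + 1) → Set V} (hC : D.IsAcyclicOrdering C) {x₀ : V}
    (h : ∀ v, D.Reach x₀ v) : C 0 = {v | D.Reach v x₀} := by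
  obtain ⟨i, hi⟩ := hC.exists_mem x₀
  obtain ⟨y, hy⟩ := (hC.isStrongComponent 0).1.1
  have : i ≤ 0 := hC.le_of_reach (h y) (hi ▸ ⟨.refl, .refl⟩) hy
  obtain rfl : i = 0 := Fin.le_zero_iff.1 this
  simp [hi, h]

theorem last_eq {C : Fin (l + 1) → Set V} (hC : D.IsAcyclicOrdering C) {xd : V}
    (h : ∀ v, D.Reach v xd) : C (Fin.last l) = {v | D.Reach xd v} := by
  obtain ⟨i, hi⟩ := hC.exists_mem xd
  obtain ⟨y, hy⟩ := (hC.isStrongComponent (Fin.last l)).1.1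
  have : Fin.last l ≤ i := hC.le_of_reach (h y) hy (hi ▸ ⟨.refl, .refl⟩)
  obtain rfl : i = Fin.last l := Fin.last_le_iff.1 this
  simp [hi, h]

end IsAcyclicOrdering

/-- The greedy path itself attains the length. No path is shorter, because `greedyDist` grows by at
most one per arc. -/
theorem IsGreedyPath.isSetDist (hD : D.IsLocallySemicomplete) {x₀ xd : V} {B T : List V}
    (hB : D.IsGreedyPath x₀ B) (hT : B ++ [x₀] = xd :: T) :
    D.IsSetDist {v | D.Reach v x₀} {v | D.Reach xd v} B.length := by
  have hlen : (B ++ [x₀]).length = B.length + 1 := by simp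
  refine ⟨⟨?_⟩, fun k ⟨p⟩ => ?_⟩
  · refine
      -- The list contains the path from its end to its start.
      { vert := fun i => (B ++ [x₀])[B.length - i]'(by omega)
        injective := fun i j hij => ?_
        adj := fun i => ?_
        start_mem := ?_
        end_mem := ?_
        inner := fun i hi hi' => ?_ }
    · have := (List.Nodup.getElem_inj_iff hB.nodup).1 hij
      ext
      omega
    · have := (List.isChain_iff_getElem.1 hB.chain) (B.length - (i + 1)) (by omega)
      have e : B.length - (i + 1) + 1 = B.length - i := by omega
      simp only [e] at this
      exact this.1
    · simp only [Set.mem_ofPred_eq, Fin.val_zero, Nat.sub_zero, List.getElem_concat_length]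
      exact .refl
    · simp only [Set.mem_ofPred_eq, Fin.val_last, Nat.sub_self, hT, List.getElem_cons_zero]
      exact .refl
    · have h0 : (i : ℕ) ≠ 0 := fun h => hi (Fin.ext h)
      have h1 : (i : ℕ) ≠ B.length := fun h => hi' (Fin.ext h)
      have h2 : (i : ℕ) ≤ B.length := by omega
      rintro (h | h)
      · refine hB.not_reach_first ?_ h
        rw [List.getElem_append_left (by omega)]
        exact List.getElem_mem _
      · refine hB.not_last_reach hT (List.getElem_mem _) ?_ h
        intro e
        have h3 : (B ++ [x₀])[0]'(by simp) = xd := by simp [hT]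
        have := (List.Nodup.getElem_inj_iff hB.nodup).1 (e.trans h3.symm)
        omega
  · have key : ∀ i : ℕ, ∀ hi : i < k + 1,
        D.greedyDist (B ++ [x₀]) (p.vert ⟨i, hi⟩) ≤ i := by
      intro i
      induction i with
      | zero => exact fun _ => (hB.greedyDist_first p.start_mem).le
      | succ i ih =>
        intro hi
        exact (hB.greedyDist_le hD (p.adj ⟨i, by omega⟩)).trans
          (Nat.add_le_add_right (ih (by omega)) 1)
    exact (hB.greedyDist_last hT p.end_mem).trans (key k (by omega))

theorem isMaxSigma_of_isGreedyPath [Fintype V] {n : ℕ} (hV : Fintype.card V = n) (hn : 3 ≤ n)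
    (hD : D.IsLocallySemicomplete) (hc : D.IsConnected)
    (h2 : D.IsStrong ∨ D.underlying.IsTwoConnected) {x₀ xd : V}
    {B T : List V} (hB : D.IsGreedyPath x₀ B) (hT : B ++ [x₀] = xd :: T)
    (hlast : ∀ u, D.Reach u xd) : D.IsMaxSigma n (n - B.length) := by
  obtain ⟨F, nxt, v, h, hall, hv⟩ :=
    exists_isPartialCycle_full (hV ▸ hn) hD hc h2 hB hT hlast
  obtain ⟨R, hR, -⟩ := h.exists_hamiltonOrientedCycle hV hB hall hv
  refine ⟨⟨R, le_antisymm (R.sigmaMax_le hD hB) (hR ▸ le_max_left _ _)⟩, ?_⟩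
  rintro _ ⟨R', rfl⟩
  exact R'.sigmaMax_le hD hB

theorem isMaxSigma_trichotomy [Fintype V] {n : ℕ} (hV : Fintype.card V = n) (hn : 3 ≤ n)
    (hc : D.IsConnected) (hD : D.IsLocallySemicomplete) :
    (¬ D.IsStrong → D.underlying.IsTwoConnected →
      ∀ (l : ℕ) (C : Fin (l + 1) → Set V), D.IsAcyclicOrdering C →
        ∃ d : ℕ, D.IsSetDist (C 0) (C (Fin.last l)) d ∧ d ≤ n ∧ D.IsMaxSigma n (n - d)) ∧
    (¬ D.IsStrong → ¬ D.underlying.IsTwoConnected → IsEmpty (D.HamiltonOrientedCycle n)) ∧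
    (D.IsStrong → D.IsMaxSigma n n) := by
  have : Nonempty V := Fintype.card_pos_iff.1 (by omega)
  obtain ⟨x₀, xd, B, T, hB, hT, hlast⟩ := exists_isGreedyPath hD hc
  refine ⟨fun _ h2 l C hC => ⟨B.length, ?_, ?_, ?_⟩, fun _ h2 => ⟨fun R => ?_⟩, fun hs => ?_⟩
  · rw [hC.first_eq hB.reach, hC.last_eq hlast]
    exact hB.isSetDist hD hT
  · have := hB.length_lt
    omega
  · exact isMaxSigma_of_isGreedyPath hV hn hD hc (.inr h2) hB hT hlast
  · exact h2 (R.underlying_isTwoConnected hn (by simp [hV]) hc)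
  · obtain rfl : B = [] := by
      cases B with
      | nil => rfl
      | cons b B => exact absurd (hs b x₀) (hB.not_reach_first (by simp))
    simpa using isMaxSigma_of_isGreedyPath hV hn hD hc (.inl hs) hB hT hlast

end Digraph

namespace RAM

/-! ### Programs whose only loops are bounded loops

The bound of each loop is the value of variable `0`. Such programs have a total semantics, and a
polynomial bound on their running time can be read off from their syntax. -/

/-- Programs in which every loop is of the form `for i < (value of variable 0)`. -/
inductive ForProg : Type
  | skip
  | assign (x : ℕ) (e : Expr)
  | store (a : ℕ) (i j e : Expr)
  | seq (p q : ForProg)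
  | ite (e : Expr) (p q : ForProg)
  | loop (i : ℕ) (p : ForProg)

namespace ForProg

/-- `k` rounds of a loop with body `f` and counter `i`. -/
def rounds (f : Store → Store) (i : ℕ) (s : Store) : ℕ → Store
  | 0 => s.setVar i 0
  | k + 1 => (f (rounds f i s k)).setVar i (k + 1)

def run : ForProg → Store → Store
  | skip, s => s
  | assign x e, s => s.setVar x (e.eval s)
  | store a i j e, s => s.setArr a (i.eval s) (j.eval s) (e.eval s)
  | seq p q, s => q.run (p.run s)
  | ite e p q, s => if e.eval s ≠ 0 then p.run s else q.run s
  | loop i p, s => rounds p.run i s (s.var 0)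

def compile : ForProg → Prog
  | skip => .skip
  | assign x e => .assign x e
  | store a i j e => .store a i j e
  | seq p q => .seq p.compile q.compile
  | ite e p q => .ite e p.compile q.compile
  | loop i p => .seq (.assign i (.lit 0)) (.while (.lt (.var i) (.var 0))
      (.seq p.compile (.assign i (.add (.var i) (.lit 1)))))

/-- The variables that may change. -/
def writes : ForProg → List ℕ
  | skip => []
  | assign x _ => [x]
  | store .. => []
  | seq p q => p.writes ++ q.writes
  | ite _ p q => p.writes ++ q.writes
  | loop i p => i :: p.writes

/-- The arrays that may change. -/
def stores : ForProg → List ℕ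
  | skip => []
  | assign .. => []
  | store a .. => [a]
  | seq p q => p.stores ++ q.stores
  | ite _ p q => p.stores ++ q.stores
  | loop _ p => p.stores

/-- No loop body changes the counter or the bound of the loop, and the bound changes at most at the
very end. -/
def WellFormed : ForProg → Prop
  | skip => True
  | assign .. => True
  | store .. => True
  | seq p q => p.WellFormed ∧ q.WellFormed ∧ 0 ∉ p.writes
  | ite _ p q => p.WellFormed ∧ q.WellFormed
  | loop i p => p.WellFormed ∧ i ≠ 0 ∧ i ∉ p.writes ∧ 0 ∉ p.writes

def decidableWellFormed : (p : ForProg) → Decidable p.WellFormed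
  | skip => .isTrue trivial
  | assign .. => .isTrue trivial
  | store .. => .isTrue trivial
  | seq p q =>
    have := decidableWellFormed p
    have := decidableWellFormed q
    inferInstanceAs (Decidable (_ ∧ _ ∧ _))
  | ite _ p q =>
    have := decidableWellFormed p
    have := decidableWellFormed q
    inferInstanceAs (Decidable (_ ∧ _))
  | loop _ p =>
    have := decidableWellFormed p
    inferInstanceAs (Decidable (_ ∧ _ ∧ _ ∧ _))

instance : DecidablePred WellFormed := decidableWellFormed

open Polynomial in
/-- A bound on the running time. -/
noncomputable def cost : ForProg → Polynomial ℕ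
  | skip => 1
  | assign .. => 1
  | store .. => 1
  | seq p q => p.cost + q.cost + 1
  | ite _ p q => p.cost + q.cost + 1
  -- Per round: the test, unfolding the body, the increment. Once: unfolding the loop, resetting the
  -- counter, the failing test.
  | loop _ p => X * (p.cost + 3) + 3

theorem rounds_var {f : Store → Store} {i x : ℕ} (hf : ∀ s, (f s).var x = s.var x) (hx : x ≠ i)
    (s : Store) (k : ℕ) : (rounds f i s k).var x = s.var x := by
  induction k with
  | zero => simp [rounds, Store.setVar, hx]
  | succ k ih => simpa [rounds, Store.setVar, hx, hf] using ih

theorem rounds_arr {f : Store → Store} {i a : ℕ} (hf : ∀ s, (f s).arr a = s.arr a)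
    (s : Store) (k : ℕ) : (rounds f i s k).arr a = s.arr a := by
  induction k with
  | zero => rfl
  | succ k ih => simpa [rounds, Store.setVar, hf] using ih

theorem rounds_counter (f : Store → Store) (i : ℕ) (s : Store) (k : ℕ) :
    (rounds f i s k).var i = k := by
  cases k <;> simp [rounds, Store.setVar]

theorem run_var {p : ForProg} {x : ℕ} (hx : x ∉ p.writes) (s : Store) :
    (p.run s).var x = s.var x := by
  induction p generalizing s with
  | skip => rfl
  | assign y e =>
    have : x ≠ y := by simpa [writes] using hx
    simp [run, Store.setVar, this]
  | store => rfl
  | seq p q hp hq =>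
    simp only [writes, List.mem_append, not_or] at hx
    rw [run, hq hx.2, hp hx.1]
  | ite e p q hp hq =>
    simp only [writes, List.mem_append, not_or] at hx
    rw [run]
    split_ifs
    exacts [hp hx.1 s, hq hx.2 s]
  | loop i p hp =>
    simp only [writes, List.mem_cons, not_or] at hx
    exact rounds_var (hp hx.2) hx.1 s _

theorem run_arr {p : ForProg} {a : ℕ} (ha : a ∉ p.stores) (s : Store) :
    (p.run s).arr a = s.arr a := by
  induction p generalizing s with
  | skip => rfl
  | assign => rfl
  | store b i j e =>
    have : a ≠ b := by simpa [stores] using ha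
    simp [run, Store.setArr, this]
  | seq p q hp hq =>
    simp only [stores, List.mem_append, not_or] at ha
    rw [run, hq ha.2, hp ha.1]
  | ite e p q hp hq =>
    simp only [stores, List.mem_append, not_or] at ha
    rw [run]
    split_ifs
    exacts [hp ha.1 s, hq ha.2 s]
  | loop i p hp => exact rounds_arr (hp ha) s _

/-- The arbitrary continuation `k` makes the induction work. Well-formedness keeps variable `0`
fixed while later parts are pending, so all costs are evaluated at the same number. -/
theorem exists_iterate_step {p : ForProg} (h : p.WellFormed) (k : List Prog) (s : Store) :
    ∃ m ≤ p.cost.eval (s.var 0), step^[m] ⟨p.compile :: k, s⟩ = ⟨k, p.run s⟩ := by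
  induction p generalizing k s with
  | skip => exact ⟨1, by simp [cost], rfl⟩
  | assign => exact ⟨1, by simp [cost], rfl⟩
  | store => exact ⟨1, by simp [cost], rfl⟩
  | seq p q hp hq =>
    obtain ⟨h1, h2, h3⟩ := h
    obtain ⟨m, hm, hm'⟩ := hp h1 (q.compile :: k) s
    obtain ⟨l, hl, hl'⟩ := hq h2 k (p.run s)
    rw [run_var h3] at hl
    refine ⟨l + (m + 1), by simp [cost]; omega, ?_⟩
    rw [Function.iterate_add_apply, Function.iterate_succ_apply]
    simp only [compile, step, hm', hl', run]
  | ite e p q hp hq =>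
    obtain ⟨h1, h2⟩ := h
    by_cases he : e.eval s ≠ 0
    · obtain ⟨m, hm, hm'⟩ := hp h1 k s
      refine ⟨m + 1, by simp [cost]; omega, ?_⟩
      rw [Function.iterate_succ_apply]
      simp only [compile, step, run, if_pos he, hm']
    · obtain ⟨m, hm, hm'⟩ := hq h2 k s
      refine ⟨m + 1, by simp [cost]; omega, ?_⟩
      rw [Function.iterate_succ_apply]
      simp only [compile, step, run, if_neg he, hm']
  | loop i p hp =>
    obtain ⟨h1, h2, h3, h4⟩ := h
    set n := s.var 0 with hn
    set w : Prog := .while (.lt (.var i) (.var 0))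
      (.seq p.compile (.assign i (.add (.var i) (.lit 1)))) with hw
    have hbound : ∀ j, (rounds p.run i s j).var 0 = n := rounds_var (run_var h4) h2.symm s
    have key : ∀ j ≤ n, ∃ m ≤ j * (p.cost.eval n + 3),
        step^[m] ⟨w :: k, s.setVar i 0⟩ = ⟨w :: k, rounds p.run i s j⟩ := by
      intro j
      induction j with
      | zero => exact fun _ => ⟨0, by simp, rfl⟩
      | succ j ih =>
        intro hj
        obtain ⟨m, hm, hm'⟩ := ih (by omega)
        obtain ⟨l, hl, hl'⟩ := hp h1 (.assign i (.add (.var i) (.lit 1)) :: w :: k)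
          (rounds p.run i s j)
        rw [hbound] at hl
        refine ⟨1 + (l + (2 + m)), by rw [Nat.succ_mul]; omega, ?_⟩
        rw [Function.iterate_add_apply, Function.iterate_add_apply, Function.iterate_add_apply, hm']
        have hstep : step^[2] ⟨w :: k, rounds p.run i s j⟩ =
            ⟨p.compile :: .assign i (.add (.var i) (.lit 1)) :: w :: k, rounds p.run i s j⟩ := by
          have : j < n := hj
          simp [hw, step, Expr.eval, rounds_counter, hbound, this]
        rw [hstep, hl']
        simp [step, Expr.eval, rounds, run_var h3, rounds_counter]
    obtain ⟨m, hm, hm'⟩ := key n le_rfl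
    refine ⟨1 + (m + 2), by simp only [cost, Polynomial.eval_add, Polynomial.eval_mul,
      Polynomial.eval_X, Polynomial.eval_ofNat]; omega, ?_⟩
    rw [Function.iterate_add_apply, Function.iterate_add_apply]
    have hstep : step^[2] ⟨(loop i p).compile :: k, s⟩ = ⟨w :: k, s.setVar i 0⟩ := by
      simp [compile, step, Expr.eval, hw]
    rw [hstep, hm']
    simp [hw, step, Expr.eval, rounds_counter, hbound, run, ← hn]

theorem haltsWithin {p : ForProg} (h : p.WellFormed) (s : Store) :
    HaltsWithin p.compile s (p.cost.eval (s.var 0)) (p.run s) :=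
  exists_iterate_step h [] s

/-- The invariant rule for bounded loops. -/
theorem run_loop {p : ForProg} {i n : ℕ} (I : ℕ → Store → Prop) (s : Store) (hn : s.var 0 = n)
    (h₀ : I 0 (s.setVar i 0))
    (h : ∀ k < n, ∀ t : Store, t.var i = k → (∀ x ∉ i :: p.writes, t.var x = s.var x) →
      (∀ a ∉ p.stores, t.arr a = s.arr a) → I k t → I (k + 1) ((p.run t).setVar i (k + 1))) :
    I n ((loop i p).run s) := by
  have key : ∀ k ≤ n, I k (rounds p.run i s k) := by
    intro k
    induction k with
    | zero => exact fun _ => h₀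
    | succ k ih =>
      intro hk
      refine h k hk _ (rounds_counter _ _ _ _) (fun x hx => ?_) (fun a ha => ?_) (ih (by omega))
      · simp only [List.mem_cons, not_or] at hx
        exact rounds_var (run_var hx.2) hx.1 s k
      · exact rounds_arr (run_arr ha) s k
  rw [run, hn]
  exact key n le_rfl

/-- Execute `p` if all tests succeed. -/
def guarded : List Expr → ForProg → ForProg
  | [], p => p
  | e :: es, p => ite e (guarded es p) skip

theorem run_guarded (es : List Expr) (p : ForProg) (s : Store) :
    (guarded es p).run s = if ∀ e ∈ es, e.eval s ≠ 0 then p.run s else s := by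
  induction es with
  | nil => simp [guarded]
  | cons e es ih =>
    rw [guarded, run, ih]
    by_cases he : e.eval s = 0 <;> simp [he, run]

/-- Execute programs one after the other. -/
def block : List ForProg → ForProg
  | [] => skip
  | [p] => p
  | p :: ps => seq p (block ps)

end ForProg
open ForProg RAM.Expr Digraph

@[simp] theorem Store.setVar_var (s : Store) (x v y : ℕ) :
    (s.setVar x v).var y = if y = x then v else s.var y := rfl

@[simp] theorem Store.setVar_arr (s : Store) (x v : ℕ) : (s.setVar x v).arr = s.arr := rfl

@[simp] theorem Store.setArr_var (s : Store) (a i j v : ℕ) : (s.setArr a i j v).var = s.var := rfl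

@[simp] theorem Store.setArr_arr (s : Store) (a i j v b k l : ℕ) :
    (s.setArr a i j v).arr b k l = if b = a ∧ k = i ∧ l = j then v else s.arr b k l := rfl

/-! ### Transitive closure -/

/-- Fill array `o` with the relation "equal, or adjacent and the second vertex is not used". -/
def closureInit (o : ℕ) : ForProg :=
  loop 2 (loop 3 (ForProg.store o (var 2) (var 3)
    -- On entries at most `1`, truncated subtraction acts as "and not" and addition as "or"; only
    -- being nonzero counts.
    (add (eq (var 2) (var 3)) (sub (get 0 (var 2) (var 3)) (get 4 (var 3) (lit 0))))))

/-- The transitive closure of array `o` by Warshall's algorithm. -/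
def closureLoop (o : ℕ) : ForProg :=
  loop 1 (loop 2 (loop 3 (guarded [get o (var 2) (var 1), get o (var 1) (var 3)]
    (ForProg.store o (var 2) (var 3) (lit 1)))))

/-- Array `o` tells which vertices can be reached from which ones outside the set of used vertices,
which is given by array `4`. -/
def closure (o : ℕ) : ForProg := seq (closureInit o) (closureLoop o)

theorem closureInit_spec {n : ℕ} {s : Store} {o : ℕ} (ho : o ≠ 0) (ho4 : o ≠ 4)
    (hn : s.var 0 = n) : ∀ i < n, ∀ j < n, ((closureInit o).run s).arr o i j =
      (if i = j then 1 else 0) + (s.arr 0 i j - s.arr 4 j 0) := by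
  have := run_loop (i := 2) (n := n) (I := fun k t => ∀ i < k, ∀ j < n, t.arr o i j =
    (if i = j then 1 else 0) + (s.arr 0 i j - s.arr 4 j 0)) s hn (by simp)
    (p := loop 3 (ForProg.store o (var 2) (var 3)
    (add (eq (var 2) (var 3)) (sub (get 0 (var 2) (var 3)) (get 4 (var 3) (lit 0)))))) ?_
  · exact this
  · intro k hk t htk htv hta hI
    have ht0 : t.var 0 = n := by rw [htv 0 (by simp [writes]), hn]
    have h0 := hta 0 (by simp [stores, ho.symm])
    have h4 := hta 4 (by simp [stores, ho4.symm])
    have key := run_loop (i := 3) (n := n) (I := fun l u => ∀ i j, (i < k ∨ i = k ∧ j < l) → j < n →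
      u.arr o i j = (if i = j then 1 else 0) + (s.arr 0 i j - s.arr 4 j 0)) t ht0
      (p := ForProg.store o (var 2) (var 3)
        (add (eq (var 2) (var 3)) (sub (get 0 (var 2) (var 3)) (get 4 (var 3) (lit 0))))) ?_ ?_
    · intro i hi j hj
      exact key i j (by omega) hj
    · intro i j hij hj
      exact hI i (by omega) j hj
    · intro l hl u hul huv hua hJ i j hij hj
      have hu2 : u.var 2 = k := by rw [huv 2 (by simp [writes]), htk]
      have hu0 := hua 0 (by simp [stores, ho.symm])
      have hu4 := hua 4 (by simp [stores, ho4.symm])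
      simp only [run, Store.setVar_arr, Store.setArr_arr, Expr.eval, hul, hu2, true_and]
      by_cases h1 : i = k ∧ j = l
      · rw [if_pos h1, h1.1, h1.2, hu0, hu4, h0, h4]
      · rw [if_neg h1]
        exact hJ i j (by omega) hj

theorem closureStep_spec (o : ℕ) (v : Store) (i j : ℕ) :
    ((guarded [get o (var 2) (var 1), get o (var 1) (var 3)]
      (ForProg.store o (var 2) (var 3) (lit 1))).run v).arr o i j ≠ 0 ↔ v.arr o i j ≠ 0 ∨
      (i = v.var 2 ∧ j = v.var 3) ∧ v.arr o (v.var 2) (v.var 1) ≠ 0 ∧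
        v.arr o (v.var 1) (v.var 3) ≠ 0 := by
  rw [run_guarded]
  simp only [List.forall_mem_cons, List.not_mem_nil, false_imp_iff, implies_true, and_true,
    Expr.eval]
  by_cases hij : i = v.var 2 ∧ j = v.var 3 <;> split_ifs with hc <;>
    simp [run, Expr.eval, hij, hc]

/-- The invariant avoids paths: the array lies between `r` and its closure and is transitive through
all intermediate vertices below `k`. At `k = n` it is transitive and so equals the closure. -/
theorem closureLoop_spec {n : ℕ} {s : Store} {o : ℕ} (hn : s.var 0 = n)
    {r : Fin n → Fin n → Prop}
    (hs : ∀ a b : Fin n, s.arr o a b ≠ 0 ↔ a = b ∨ r a b) (a b : Fin n) :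
    ((closureLoop o).run s).arr o a b ≠ 0 ↔ Relation.ReflTransGen r a b := by
  have := run_loop (i := 1) (n := n) (I := fun k t =>
      (∀ a b : Fin n, t.arr o a b ≠ 0 → Relation.ReflTransGen r a b) ∧
      (∀ a b : Fin n, a = b ∨ r a b → t.arr o a b ≠ 0) ∧
      ∀ a b c : Fin n, (c : ℕ) < k → t.arr o a c ≠ 0 → t.arr o c b ≠ 0 → t.arr o a b ≠ 0) s hn
    (p := loop 2 (loop 3 (guarded [get o (var 2) (var 1), get o (var 1) (var 3)]
      (ForProg.store o (var 2) (var 3) (lit 1))))) ?_ ?_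
  · obtain ⟨h1, h2, h3⟩ := this
    refine ⟨h1 a b, fun h => ?_⟩
    induction h with
    | refl => exact h2 a a (.inl rfl)
    | @tail b c _ hbc ih => exact h3 a c b b.2 ih (h2 b c (.inr hbc))
  · refine ⟨fun a b h => ?_, fun a b h => (hs a b).2 h, fun _ _ c hc => by omega⟩
    rcases (hs a b).1 h with rfl | h
    exacts [.refl, .single h]
  · intro k hk t htk htv hta hI
    have ht0 : t.var 0 = n := by rw [htv 0 (by simp [writes, guarded]), hn]
    have key := run_loop (i := 2) (n := n) (I := fun l u => ∀ i < n, ∀ j < n, (u.arr o i j ≠ 0 ↔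
        t.arr o i j ≠ 0 ∨ i < l ∧ t.arr o i k ≠ 0 ∧ t.arr o k j ≠ 0)) t ht0
      (p := loop 3 (guarded [get o (var 2) (var 1), get o (var 1) (var 3)]
        (ForProg.store o (var 2) (var 3) (lit 1)))) (by simp) ?_
    · obtain ⟨h1, h2, h3⟩ := hI
      have key' : ∀ a b : Fin n, (((loop 2 (loop 3 (guarded
          [get o (var 2) (var 1), get o (var 1) (var 3)]
          (ForProg.store o (var 2) (var 3) (lit 1))))).run t).setVar 1 (k + 1)).arr o a b ≠ 0 ↔
          t.arr o a b ≠ 0 ∨ t.arr o a k ≠ 0 ∧ t.arr o k b ≠ 0 := fun a b => by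
        simpa using key a a.2 b b.2
      refine ⟨fun a b h => ?_, fun a b h => (key' a b).2 (.inl (h2 a b h)), ?_⟩
      · rcases (key' a b).1 h with h | ⟨h, h'⟩
        · exact h1 a b h
        · exact (h1 a ⟨k, hk⟩ h).trans (h1 ⟨k, hk⟩ b h')
      · intro a b c hc hac hcb
        rw [key'] at hac hcb ⊢
        have h4 := fun a b => h3 a b c
        by_cases hck : (c : ℕ) = k
        · rw [hck] at hac hcb
          right
          tauto
        · have hck' : (c : ℕ) < k := by omega
          have h5 := h4 a ⟨k, hk⟩ hck'
          have h6 := h4 ⟨k, hk⟩ b hck'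
          have h7 := h4 a b hck'
          simp only at h5 h6 h7
          tauto
    · intro l hl u hul huv hua hJ
      have hu0 : u.var 0 = n := by rw [huv 0 (by simp [writes, guarded]), ht0]
      have hu1 : u.var 1 = k := by rw [huv 1 (by simp [writes, guarded]), htk]
      have := run_loop (i := 3) (n := n) (I := fun m v => ∀ i < n, ∀ j < n, (v.arr o i j ≠ 0 ↔
        t.arr o i j ≠ 0 ∨ (i < l ∨ i = l ∧ j < m) ∧ t.arr o i k ≠ 0 ∧ t.arr o k j ≠ 0)) u hu0
        (p := guarded [get o (var 2) (var 1), get o (var 1) (var 3)]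
        (ForProg.store o (var 2) (var 3) (lit 1))) ?_ ?_
      · intro i hi j hj
        rw [Store.setVar_arr, this i hi j hj]
        have : (i < l ∨ i = l ∧ j < n) ↔ i < l + 1 := by omega
        rw [this]
      · intro i hi j hj
        rw [Store.setVar_arr, hJ i hi j hj]
        simp
      · intro m hm v hvm hvv hva hK i hi j hj
        have hv1 : v.var 1 = k := by rw [hvv 1 (by simp [writes, guarded]), hu1]
        have hv2 : v.var 2 = l := by rw [hvv 2 (by simp [writes, guarded]), hul]
        -- Round `k` does not change which entries of row and column `k` are nonzero, so updating in
        -- place does no harm.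
        have e1 := (hK l hl k hk).trans (or_iff_left_of_imp fun h => h.2.1)
        have e2 := (hK k hk m hm).trans (or_iff_left_of_imp fun h => h.2.2)
        have e3 := hK i hi j hj
        rw [Store.setVar_arr, closureStep_spec, hv1, hv2, hvm, e1, e2, e3]
        by_cases hij : i = l ∧ j = m
        · obtain ⟨rfl, rfl⟩ := hij
          simp only [lt_irrefl, true_and, and_true, or_self, false_and, or_false, false_or,
            Nat.lt_succ_self]
        · have e4 : (i < l ∨ i = l ∧ j < m + 1) ↔ (i < l ∨ i = l ∧ j < m) := by omega
          rw [e4]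
          simp only [hij, false_and, or_false]

theorem closure_spec {n : ℕ} {D : Digraph (Fin n)} {s : Store} {o : ℕ} (ho : o ≠ 0) (ho4 : o ≠ 4)
    (hn : s.var 0 = n) (hA : ∀ u v : Fin n, s.arr 0 u v ≠ 0 ↔ D.Adj u v)
    (hA1 : ∀ u v : Fin n, s.arr 0 u v ≤ 1)
    {U : Set (Fin n)} (hU : ∀ v : Fin n, s.arr 4 v 0 ≠ 0 ↔ v ∈ U) (a b : Fin n) :
    ((closure o).run s).arr o a b ≠ 0 ↔ D.AvoidReach U a b := by
  refine closureLoop_spec (by rw [run_var (by simp [writes, closureInit]), hn]) (fun a b => ?_) a b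
  rw [closureInit_spec ho ho4 hn a a.2 b b.2, ← hA, ← hU]
  have := hA1 a b
  by_cases hab : a = b
  · simp [hab]
  · have : (a : ℕ) ≠ b := fun h => hab (Fin.ext h)
    simp [hab, this]
    omega

/-! ### The programs of the algorithm -/

/-- Variable `4` becomes a vertex that reaches all the others. -/
def findFirst : ForProg :=
  seq (ForProg.assign 4 (lit 0)) (loop 1 (guarded [get 2 (var 1) (var 4)]
    (ForProg.assign 4 (var 1))))

/-- Variable `7` becomes a last one among the out-neighbours of variable `5`. -/
def findBest : ForProg :=
  seq (ForProg.assign 7 (var 5)) (loop 1 (guarded [get 0 (var 5) (var 1), get 2 (var 7) (var 1)]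
    (ForProg.assign 7 (var 1))))

/-- Extend the greedy path, unless its end is in the last strong component. -/
def extendPath : ForProg :=
  guarded [eq (get 2 (var 7) (var 5)) (lit 0)] (block [
    ForProg.store 5 (var 7) (lit 0) (var 5),
    ForProg.store 4 (var 7) (lit 0) (lit 1),
    ForProg.assign 5 (var 7),
    ForProg.assign 6 (add (var 6) (lit 1))])

/-- The greedy path from variable `4` to variable `5`, of length given by variable `6`; its vertices
are marked as used in array `4`, and their predecessors are in array `5`. -/
def greedyPath : ForProg :=
  block [ForProg.assign 5 (var 4), ForProg.assign 6 (lit 0),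
    ForProg.store 4 (var 4) (lit 0) (lit 1), loop 14 (seq findBest extendPath)]

/-- Close the greedy path to a cycle; array `6` marks the vertices of its forward part, and variable
`8` is the vertex after which the arc is possibly missing. -/
def startCycle : ForProg :=
  block [ForProg.store 5 (var 4) (lit 0) (var 5), ForProg.store 6 (var 4) (lit 0) (lit 1),
    ForProg.assign 8 (var 4)]

/-- The tests whether `x`, `w`, `z` (variables `1`, `2`, `3`) give rise to an insertion of `w` after
`x`. -/
def searchTests : List Expr :=
  [get 6 (var 1) (lit 0),
    add (get 0 (var 8) (get 5 (var 8) (lit 0))) (eq (var 1) (var 8)),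
    eq (get 4 (var 2) (lit 0)) (lit 0), get 0 (var 1) (var 2), get 3 (var 2) (var 3),
    get 0 (var 3) (get 5 (var 1) (lit 0))]

def searchBody : ForProg :=
  guarded searchTests (block [ForProg.assign 9 (lit 1), ForProg.assign 10 (var 1),
    ForProg.assign 11 (var 2)])

/-- Variable `9` tells whether an insertion is possible, namely of variable `11` after variable
`10`. -/
def search : ForProg :=
  seq (ForProg.assign 9 (lit 0)) (loop 1 (loop 2 (loop 3 searchBody)))

def insertVertex : ForProg :=
  guarded [var 9] (block [
    ForProg.store 5 (var 11) (lit 0) (get 5 (var 10) (lit 0)),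
    ForProg.store 5 (var 10) (lit 0) (var 11),
    ForProg.store 6 (var 11) (lit 0) (lit 1),
    ForProg.store 4 (var 11) (lit 0) (lit 1),
    ForProg.assign 8 (var 11)])

def extendCycle : ForProg := loop 14 (block [closure 3, search, insertVertex])

/-- Variable `12` tells whether the cycle is complete. -/
def checkCycle : ForProg :=
  seq (ForProg.assign 12 (get 0 (var 8) (get 5 (var 8) (lit 0))))
    (loop 1 (guarded [eq (get 4 (var 1) (lit 0)) (lit 0)] (ForProg.assign 12 (lit 0))))

def outputBody : ForProg :=
  block [ForProg.store 1 (var 1) (lit 0) (var 13),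
    ForProg.store 1 (var 1) (lit 1) (lt (var 1) (sub (var 0) (var 6))),
    ForProg.assign 13 (get 5 (var 13) (lit 0))]

def output : ForProg := seq (ForProg.assign 13 (var 4)) (loop 1 outputBody)

/-- The algorithm that finds a Hamilton oriented cycle with the maximum number of forward arcs. -/
def hamiltonProg : ForProg :=
  block [closure 2, findFirst, greedyPath, startCycle, extendCycle, checkCycle, output,
    ForProg.assign 0 (var 12)]

/-! ### Correctness of the programs -/

theorem run_guarded_pos {es : List Expr} {p : ForProg} {s : Store} (h : ∀ e ∈ es, e.eval s ≠ 0) :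
    (guarded es p).run s = p.run s := by
  rw [run_guarded, if_pos h]

theorem run_guarded_neg {es : List Expr} {p : ForProg} {s : Store}
    (h : ¬ ∀ e ∈ es, e.eval s ≠ 0) : (guarded es p).run s = s := by
  rw [run_guarded, if_neg h]

theorem hamiltonProg_wellFormed : hamiltonProg.WellFormed := by decide

/-- Variable `0` contains the number of vertices, and array `0` contains the adjacency matrix. -/
structure HasGraph {n : ℕ} (D : Digraph (Fin n)) (s : Store) : Prop where
  bound : s.var 0 = n
  adj : ∀ u v : Fin n, s.arr 0 u v ≠ 0 ↔ D.Adj u v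
  le_one : ∀ u v : Fin n, s.arr 0 u v ≤ 1

variable {n : ℕ} {D : Digraph (Fin n)}

theorem HasGraph.congr {s t : Store} (h : HasGraph D s) (h0 : t.var 0 = s.var 0)
    (ha : t.arr 0 = s.arr 0) : HasGraph D t where
  bound := h0.trans h.bound
  adj := by rw [ha]; exact h.adj
  le_one := by rw [ha]; exact h.le_one

theorem HasGraph.run {s : Store} (h : HasGraph D s) {p : ForProg} (h0 : 0 ∉ p.writes)
    (ha : 0 ∉ p.stores) : HasGraph D (p.run s) :=
  h.congr (run_var h0 s) (run_arr ha s)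

theorem hasGraph_input : HasGraph D (input D) where
  bound := rfl
  adj u v := by simp [input]
  le_one u v := by simp only [input]; split_ifs <;> omega

/-- Array `2` contains the reachability relation. -/
def HasReach (D : Digraph (Fin n)) (s : Store) : Prop :=
  ∀ u v : Fin n, s.arr 2 u v ≠ 0 ↔ D.Reach u v

theorem closure_two_spec {s : Store} (h : HasGraph D s) (h4 : ∀ v : Fin n, s.arr 4 v 0 = 0) :
    HasReach D ((closure 2).run s) := by
  intro u v
  rw [closure_spec (D := D) (U := ∅) (by simp) (by simp) h.bound h.adj h.le_one (by simpa using h4)]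
  simp [AvoidReach]

/-- Reachability is a total preorder, so a single scan that keeps the best vertex so far finds an
extremal one. -/
theorem findFirst_spec {s : Store} (hn : 0 < n) (hD : D.IsLocallySemicomplete)
    (hc : D.IsConnected) (h : HasGraph D s) (hr : HasReach D s) :
    ∃ x₀ : Fin n, (findFirst.run s).var 4 = x₀ ∧ ∀ v, D.Reach x₀ v := by
  have := run_loop (i := 1) (n := n) (I := fun k t => ∃ x : Fin n, t.var 4 = x ∧
    ∀ v : Fin n, (v : ℕ) < k → D.Reach x v) ((ForProg.assign 4 (lit 0)).run s) h.bound
    (p := guarded [get 2 (var 1) (var 4)] (ForProg.assign 4 (var 1)))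
    ⟨⟨0, hn⟩, by simp [run, Expr.eval], by simp⟩ ?_
  · obtain ⟨x, hx, hv⟩ := this
    exact ⟨x, hx, fun v => hv v v.2⟩
  · rintro k hk t htk htv hta ⟨x, hx, hv⟩
    have ht2 : HasReach D t := by
      intro u v
      rw [hta 2 (by decide)]
      exact hr u v
    have hif : (∀ e ∈ [get 2 (var 1) (var 4)], e.eval t ≠ 0) ↔ D.Reach ⟨k, hk⟩ x := by
      simp only [List.forall_mem_singleton, Expr.eval, htk, hx]
      exact ht2 ⟨k, hk⟩ x
    by_cases hkx : D.Reach ⟨k, hk⟩ x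
    · rw [run_guarded_pos (hif.2 hkx)]
      refine ⟨⟨k, hk⟩, by simp [run, Expr.eval, htk], fun v hvk => ?_⟩
      rcases Nat.lt_succ_iff_lt_or_eq.1 hvk with hvk | rfl
      exacts [hkx.trans (hv v hvk), .refl]
    · rw [run_guarded_neg (mt hif.1 hkx)]
      refine ⟨x, by simpa using hx, fun v hvk => ?_⟩
      rcases Nat.lt_succ_iff_lt_or_eq.1 hvk with hvk | rfl
      exacts [hv v hvk, (hD.reach_total hc v x).resolve_left hkx]

theorem findBest_spec {s : Store} (hD : D.IsLocallySemicomplete)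
    (hc : D.IsConnected) (h : HasGraph D s) (hr : HasReach D s) {a : Fin n} (ha : s.var 5 = a) :
    ∃ b : Fin n, (findBest.run s).var 7 = b ∧ (D.Adj a b ∨ b = a) ∧
      ∀ y, D.Adj a y → D.Reach y b := by
  have := run_loop (i := 1) (n := n) (I := fun k t => ∃ b : Fin n, t.var 7 = b ∧
    (D.Adj a b ∨ b = a) ∧ ∀ y : Fin n, (y : ℕ) < k → D.Adj a y → D.Reach y b)
    ((ForProg.assign 7 (var 5)).run s) h.bound
    (p := guarded [get 0 (var 5) (var 1), get 2 (var 7) (var 1)] (ForProg.assign 7 (var 1)))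
    ⟨a, by simp [run, Expr.eval, ha], .inr rfl, by simp⟩ ?_
  · obtain ⟨b, hb, hab, hy⟩ := this
    exact ⟨b, hb, hab, fun y => hy y y.2⟩
  · rintro k hk t htk htv hta ⟨b, hb, hab, hy⟩
    have h0 := hta 0 (by decide)
    have h2 := hta 2 (by decide)
    have h5 : t.var 5 = a := by rw [htv 5 (by decide)]; exact ha
    have hif : (∀ e ∈ [get 0 (var 5) (var 1), get 2 (var 7) (var 1)], e.eval t ≠ 0) ↔
        D.Adj a ⟨k, hk⟩ ∧ D.Reach b ⟨k, hk⟩ := by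
      simp only [List.forall_mem_cons, List.not_mem_nil, false_imp_iff, implies_true, and_true,
        Expr.eval, htk, h5, hb, h0, h2]
      exact and_congr (h.adj a ⟨k, hk⟩) (hr b ⟨k, hk⟩)
    by_cases hkx : D.Adj a ⟨k, hk⟩ ∧ D.Reach b ⟨k, hk⟩
    · rw [run_guarded_pos (hif.2 hkx)]
      refine ⟨⟨k, hk⟩, by simp [run, Expr.eval, htk], .inl hkx.1, fun y hyk hay => ?_⟩
      rcases Nat.lt_succ_iff_lt_or_eq.1 hyk with hyk | rfl
      exacts [(hy y hyk hay).trans hkx.2, .refl]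
    · rw [run_guarded_neg (mt hif.1 hkx)]
      refine ⟨b, by simpa using hb, hab, fun y hyk hay => ?_⟩
      rcases Nat.lt_succ_iff_lt_or_eq.1 hyk with hyk | rfl
      exacts [hy y hyk hay, (hD.reach_total hc y b).resolve_right fun h => hkx ⟨hay, h⟩]

/-- The store describes the greedy path that is the reverse of `B ++ [x₀]`. -/
structure HasPath (x₀ xd : Fin n) (B : List (Fin n)) (nxt : Fin n → Fin n) (s : Store) : Prop where
  first : s.var 4 = x₀
  last : s.var 5 = xd
  length : s.var 6 = B.length
  used : ∀ u : Fin n, s.arr 4 u 0 ≠ 0 ↔ u ∈ B ++ [x₀]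
  succ : ∀ u : Fin n, s.arr 5 u 0 = nxt u
  chain : (B ++ [x₀]).IsChain fun a b => nxt a = b

theorem HasPath.congr {x₀ xd : Fin n} {B : List (Fin n)} {nxt : Fin n → Fin n} {s t : Store}
    (h : HasPath x₀ xd B nxt s) (hv4 : t.var 4 = s.var 4) (hv5 : t.var 5 = s.var 5)
    (hv6 : t.var 6 = s.var 6) (ha4 : t.arr 4 = s.arr 4) (ha5 : t.arr 5 = s.arr 5) :
    HasPath x₀ xd B nxt t where
  first := hv4.trans h.first
  last := hv5.trans h.last
  length := hv6.trans h.length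
  used := by rw [ha4]; exact h.used
  succ := by rw [ha5]; exact h.succ
  chain := h.chain

theorem extendPath_spec {s : Store} {x₀ xd b : Fin n} {B T : List (Fin n)} {nxt : Fin n → Fin n}
    (hD : D.IsLocallySemicomplete) (hc : D.IsConnected) (hr : HasReach D s)
    (h : HasPath x₀ xd B nxt s) (hB : D.IsGreedyPath x₀ B) (hT : B ++ [x₀] = xd :: T)
    (hb : s.var 7 = b) (hxb : D.Adj xd b ∨ b = xd) (hmax : ∀ y, D.Adj xd y → D.Reach y b) :
    ((∀ u, D.Reach u xd) ∧ extendPath.run s = s) ∨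
      D.IsGreedyPath x₀ (b :: B) ∧
        HasPath x₀ b (b :: B) (Function.update nxt b xd) (extendPath.run s) := by
  rw [extendPath]
  have hif : (∀ e ∈ [eq (get 2 (var 7) (var 5)) (lit 0)], e.eval s ≠ 0) ↔ ¬ D.Reach b xd := by
    rw [← hr b xd]
    simp [Expr.eval, hb, h.last]
  by_cases hbd : D.Reach b xd
  · exact .inl ⟨reach_of_forall_out hD hc hmax hbd, run_guarded_neg fun h => hif.1 h hbd⟩
  · right
    have hxb' : D.Adj xd b := hxb.resolve_right fun e => hbd (e ▸ .refl)
    have hB' := hB.cons hT ⟨hxb', hbd, hmax⟩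
    have hno := hB'.nodup
    refine ⟨hB', ?_⟩
    rw [run_guarded_pos (hif.2 hbd)]
    refine ⟨?_, ?_, ?_, fun u => ?_, fun u => ?_, ?_⟩
    · simpa [block, run] using h.first
    · simp [block, run, Expr.eval, hb]
    · simp [block, run, Expr.eval, h.length]
    · have := h.used u
      by_cases hub : u = b
      · simp [block, run, Expr.eval, hb, hub]
      · have hub' : (u : ℕ) ≠ b := fun e => hub (Fin.ext e)
        simpa [block, run, Expr.eval, hb, hub, hub'] using this
    · by_cases hub : u = b
      · simp [block, run, Expr.eval, hb, hub, h.last]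
      · have hub' : (u : ℕ) ≠ b := fun e => hub (Fin.ext e)
        simp [block, run, Expr.eval, hb, hub, hub', h.succ]
    · have hch := isChain_concat_congr (g := Function.update nxt b xd) h.chain fun a ha => by
        rw [Function.update_of_ne]
        rintro rfl
        exact (List.nodup_cons.1 hno).1 (by simp [ha])
      rw [List.cons_append]
      rw [hT] at hch ⊢
      exact List.isChain_cons_cons.2 ⟨by simp, hch⟩

theorem greedyPath_spec {s : Store} (hD : D.IsLocallySemicomplete)
    (hc : D.IsConnected) (h : HasGraph D s) (hr : HasReach D s) {x₀ : Fin n}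
    (hx₀ : ∀ v, D.Reach x₀ v) (h4 : s.var 4 = x₀) (hu : ∀ u : Fin n, s.arr 4 u 0 = 0)
    (hnx : ∀ u : Fin n, s.arr 5 u 0 = 0) :
    ∃ (xd : Fin n) (B T : List (Fin n)) (nxt : Fin n → Fin n), D.IsGreedyPath x₀ B ∧
      B ++ [x₀] = xd :: T ∧ (∀ u, D.Reach u xd) ∧
      HasPath x₀ xd B nxt (greedyPath.run s) := by
  have := run_loop (i := 14) (n := n) (I := fun k t => ∃ (xd : Fin n) (B T : List (Fin n))
      (nxt : Fin n → Fin n), D.IsGreedyPath x₀ B ∧ B ++ [x₀] = xd :: T ∧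
      ((∀ u, D.Reach u xd) ∨ B.length = k) ∧ HasPath x₀ xd B nxt t)
    ((ForProg.store 4 (var 4) (lit 0) (lit 1)).run ((ForProg.assign 6 (lit 0)).run
      ((ForProg.assign 5 (var 4)).run s))) h.bound (p := seq findBest extendPath) ?_ ?_
  · obtain ⟨xd, B, T, nxt, hB, hT, hl, hP⟩ := this
    refine ⟨xd, B, T, nxt, hB, hT, hl.resolve_right fun hl => ?_, hP⟩
    have := hB.length_lt
    simp only [Fintype.card_fin] at this
    omega
  · refine ⟨x₀, [], [], fun _ => ⟨0, x₀.pos⟩, isGreedyPath_nil hx₀, rfl, .inr rfl, ?_⟩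
    refine ⟨?_, ?_, ?_, fun u => ?_, fun u => ?_, by simp⟩
    · simp [run, h4]
    · simp [run, Expr.eval, h4]
    · simp [run, Expr.eval]
    · simp [run, Expr.eval, h4, hu, Fin.ext_iff]
    · simp [run, hnx]
  · rintro k hk t - htv hta ⟨xd, B, T, nxt, hB, hT, hl, hP⟩
    have hG : HasGraph D t := h.congr (by rw [htv 0 (by decide)]; rfl)
      (by rw [hta 0 (by decide)]; ext; simp [run])
    have hR : HasReach D t := by
      intro u v
      rw [hta 2 (by decide), ← hr u v]
      simp [run]
    obtain ⟨b, hb, hxb, hmax⟩ := findBest_spec hD hc hG hR hP.last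
    have hR' : HasReach D (findBest.run t) := by
      intro u v
      rw [run_arr (by decide)]
      exact hR u v
    have hP' : HasPath x₀ xd B nxt (findBest.run t) :=
      hP.congr (run_var (by decide) t) (run_var (by decide) t) (run_var (by decide) t)
        (run_arr (by decide) t) (run_arr (by decide) t)
    rw [run]
    rcases extendPath_spec hD hc hR' hP' hB hT hb hxb hmax with ⟨h1, h2⟩ | ⟨h1, h2⟩
    · refine ⟨xd, B, T, nxt, hB, hT, .inl h1, ?_⟩
      rw [h2]
      exact hP'.congr rfl rfl rfl rfl rfl
    · by_cases hl' : ∀ u, D.Reach u b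
      · exact ⟨b, b :: B, xd :: T, _, h1, by simp [hT], .inl hl', h2.congr rfl rfl rfl rfl rfl⟩
      · refine ⟨b, b :: B, xd :: T, _, h1, by simp [hT], .inr ?_, h2.congr rfl rfl rfl rfl rfl⟩
        rcases hl with hl | hl
        -- A path that had already arrived in the last component cannot have been extended.
        · have hn := (List.isChain_cons_cons.1 (hT ▸ h1.chain :
            (b :: xd :: T).IsChain fun b a => D.IsBestOut a b)).1
          exact absurd (hl b) hn.2.1
        · simp [hl]

/-- The store describes a partial cycle. -/
structure HasCycle (x₀ : Fin n) (B F : List (Fin n)) (nxt : Fin n → Fin n) (v : Fin n)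
    (s : Store) : Prop where
  first : s.var 4 = x₀
  length : s.var 6 = B.length
  open_at : s.var 8 = v
  used : ∀ u : Fin n, s.arr 4 u 0 ≠ 0 ↔ u ∈ F ++ B
  forward : ∀ u : Fin n, s.arr 6 u 0 ≠ 0 ↔ u ∈ F
  succ : ∀ u : Fin n, s.arr 5 u 0 = nxt u

theorem HasCycle.congr {x₀ v : Fin n} {B F : List (Fin n)} {nxt : Fin n → Fin n} {s t : Store}
    (h : HasCycle x₀ B F nxt v s) (hv4 : t.var 4 = s.var 4) (hv6 : t.var 6 = s.var 6)
    (hv8 : t.var 8 = s.var 8) (ha4 : t.arr 4 = s.arr 4) (ha5 : t.arr 5 = s.arr 5)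
    (ha6 : t.arr 6 = s.arr 6) : HasCycle x₀ B F nxt v t where
  first := hv4.trans h.first
  length := hv6.trans h.length
  open_at := hv8.trans h.open_at
  used := by rw [ha4]; exact h.used
  forward := by rw [ha6]; exact h.forward
  succ := by rw [ha5]; exact h.succ

theorem startCycle_spec {s : Store} {x₀ xd : Fin n} {B T : List (Fin n)} {nxt : Fin n → Fin n}
    (h : HasPath x₀ xd B nxt s) (hB : D.IsGreedyPath x₀ B) (hT : B ++ [x₀] = xd :: T)
    (h6 : ∀ u : Fin n, s.arr 6 u 0 = 0) :
    D.IsPartialCycle x₀ B [x₀] (Function.update nxt x₀ xd) x₀ ∧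
      HasCycle x₀ B [x₀] (Function.update nxt x₀ xd) x₀ (startCycle.run s) := by
  refine ⟨isPartialCycle_start hB hT (by simp) ?_, ?_, ?_, ?_, fun u => ?_, fun u => ?_,
    fun u => ?_⟩
  · refine isChain_concat_congr h.chain fun a ha => ?_
    rw [Function.update_of_ne]
    rintro rfl
    exact hB.not_reach_first ha .refl
  · simpa [startCycle, block, run] using h.first
  · simpa [startCycle, block, run] using h.length
  · simpa [startCycle, block, run, Expr.eval] using h.first
  · have := h.used u
    simp only [List.mem_append, List.mem_singleton] at this ⊢
    rw [or_comm, ← this]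
    simp [startCycle, block, run]
  · simp [startCycle, block, run, Expr.eval, h.first, h6, Fin.ext_iff]
  · by_cases hu : u = x₀
    · simp [startCycle, block, run, Expr.eval, h.first, h.last, hu]
    · have hu' : (u : ℕ) ≠ x₀ := fun e => hu (Fin.ext e)
      simp [startCycle, block, run, Expr.eval, h.first, h.succ, hu, hu']

theorem searchTests_iff {s : Store} {x₀ v : Fin n} {B F : List (Fin n)} {nxt : Fin n → Fin n}
    (hG : HasGraph D s) (h : HasCycle x₀ B F nxt v s)
    (h3 : ∀ a b : Fin n, s.arr 3 a b ≠ 0 ↔ D.AvoidReach {u | u ∈ F ++ B} a b) {x w z : Fin n}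
    (hx : s.var 1 = x) (hw : s.var 2 = w) (hz : s.var 3 = z) :
    (∀ e ∈ searchTests, e.eval s ≠ 0) ↔ x ∈ F ∧ (D.Adj v (nxt v) ∨ x = v) ∧ w ∉ F ++ B ∧
      D.Adj x w ∧ D.AvoidReach {u | u ∈ F ++ B} w z ∧ D.Adj z (nxt x) := by
  have h1 : (eq (get 4 (var 2) (lit 0)) (lit 0)).eval s ≠ 0 ↔ w ∉ F ++ B := by
    rw [← h.used w]
    simp [Expr.eval, hw]
  have h2 : (add (get 0 (var 8) (get 5 (var 8) (lit 0))) (eq (var 1) (var 8))).eval s ≠ 0 ↔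
      D.Adj v (nxt v) ∨ x = v := by
    rw [← hG.adj v (nxt v)]
    simp [Expr.eval, hx, h.open_at, h.succ, Fin.ext_iff]
    tauto
  simp only [searchTests, List.forall_mem_cons, List.not_mem_nil, false_imp_iff, implies_true,
    and_true, h1, h2]
  simp only [Expr.eval, hx, hw, hz, h.succ, ← h.forward, ← h3, ← hG.adj]

theorem search_spec {s : Store} {x₀ v : Fin n} {B F : List (Fin n)} {nxt : Fin n → Fin n}
    (hG : HasGraph D s) (h : HasCycle x₀ B F nxt v s)
    (h3 : ∀ a b : Fin n, s.arr 3 a b ≠ 0 ↔ D.AvoidReach {u | u ∈ F ++ B} a b) :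
    ((search.run s).var 9 ≠ 0 → ∃ x w : Fin n, (search.run s).var 10 = x ∧
      (search.run s).var 11 = w ∧ D.CanInsert B F nxt v x w) ∧
    ((search.run s).var 9 = 0 → ¬ ∃ x w, D.CanInsert B F nxt v x w) := by
  let Sound : Store → Prop := fun t => t.var 9 ≠ 0 → ∃ x w : Fin n, t.var 10 = x ∧
    t.var 11 = w ∧ D.CanInsert B F nxt v x w
  let Cond : Fin n → Fin n → Fin n → Prop := fun x w z => x ∈ F ∧ (D.Adj v (nxt v) ∨ x = v) ∧
    w ∉ F ++ B ∧ D.Adj x w ∧ D.AvoidReach {u | u ∈ F ++ B} w z ∧ D.Adj z (nxt x)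
  have frame : ∀ t : Store, (∀ x ∉ [1, 2, 3, 9, 10, 11], t.var x = s.var x) →
      (∀ a, t.arr a = s.arr a) → HasGraph D t ∧ HasCycle x₀ B F nxt v t ∧
      ∀ a b : Fin n, t.arr 3 a b ≠ 0 ↔ D.AvoidReach {u | u ∈ F ++ B} a b := fun t hv ha =>
    ⟨hG.congr (hv 0 (by decide)) (ha 0), h.congr (hv 4 (by decide)) (hv 6 (by decide))
      (hv 8 (by decide)) (ha 4) (ha 5) (ha 6), by rw [ha 3]; exact h3⟩
  -- Besides soundness of the recorded pair, the invariants of the three loops say that variable `9`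
  -- is set if one of the triples scanned so far, in lexicographic order, qualifies.
  have := run_loop (i := 1) (n := n) (I := fun i t => Sound t ∧
      ∀ x w z : Fin n, (x : ℕ) < i → Cond x w z → t.var 9 ≠ 0)
    ((ForProg.assign 9 (lit 0)).run s) hG.bound (p := loop 2 (loop 3 searchBody)) ?_ ?_
  · obtain ⟨h1, h2⟩ := this
    refine ⟨h1, fun h9 => ?_⟩
    rintro ⟨x, w, hx, hv, hw, hxw, z, hwz, hz⟩
    exact h2 x w z x.2 ⟨hx, hv, hw, hxw, hwz, hz⟩ h9
  · refine ⟨fun h9 => ?_, fun x w z hx => absurd hx (by omega)⟩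
    simp [run, Expr.eval] at h9
  rintro i hi t hti htv hta ⟨hts, htc⟩
  have htn : t.var 0 = n := by rw [htv 0 (by decide)]; exact hG.bound
  have := run_loop (i := 2) (n := n) (I := fun j t => Sound t ∧
      ∀ x w z : Fin n, ((x : ℕ) < i ∨ (x : ℕ) = i ∧ (w : ℕ) < j) → Cond x w z → t.var 9 ≠ 0)
    t htn (p := loop 3 searchBody) ?_ ?_
  · exact ⟨this.1, fun x w z hx => this.2 x w z (by omega)⟩
  · exact ⟨hts, fun x w z hx => htc x w z (by omega)⟩
  rintro j hj t' htj htv' hta' ⟨hts', htc'⟩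
  have htn' : t'.var 0 = n := by rw [htv' 0 (by decide), htn]
  have := run_loop (i := 3) (n := n) (I := fun k t => Sound t ∧
      ∀ x w z : Fin n, ((x : ℕ) < i ∨ (x : ℕ) = i ∧ ((w : ℕ) < j ∨ (w : ℕ) = j ∧ (z : ℕ) < k)) →
        Cond x w z → t.var 9 ≠ 0)
    t' htn' (p := searchBody) ?_ ?_
  · exact ⟨this.1, fun x w z hx => this.2 x w z (by omega)⟩
  · exact ⟨hts', fun x w z hx => htc' x w z (by omega)⟩
  rintro k hk u huk huv hua ⟨hus, huc⟩
  have hui : u.var 1 = i := by rw [huv 1 (by decide), htv' 1 (by decide), hti]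
  have huj : u.var 2 = j := by rw [huv 2 (by decide), htj]
  obtain ⟨hG', hC', h3'⟩ := frame u (fun x hx => by
      have hx' : x ∉ 3 :: searchBody.writes := by
        intro hx'; simp [searchBody, guarded, searchTests, block, writes] at hx hx'; omega
      have hx2 : x ∉ 2 :: (loop 3 searchBody).writes := by
        intro hx'; simp [searchBody, guarded, searchTests, block, writes] at hx hx'; omega
      have hx1 : x ∉ 1 :: (loop 2 (loop 3 searchBody)).writes := by
        intro hx'; simp [searchBody, guarded, searchTests, block, writes] at hx hx'; omega
      have hx9 : x ≠ 9 := by rintro rfl; simp at hx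
      rw [huv x hx', htv' x hx2, htv x hx1]
      simp [run, hx9])
    (fun a => by
      rw [hua a (by simp [searchBody, guarded, searchTests, block, stores]),
        hta' a (by simp [searchBody, guarded, searchTests, block, stores]),
        hta a (by simp [searchBody, guarded, searchTests, block, stores])]
      rfl)
  have hif := searchTests_iff hG' hC' h3' (x := ⟨i, hi⟩) (w := ⟨j, hj⟩) (z := ⟨k, hk⟩) hui huj huk
  rw [searchBody]
  by_cases hc : Cond ⟨i, hi⟩ ⟨j, hj⟩ ⟨k, hk⟩
  · rw [run_guarded_pos (hif.2 hc)]
    refine ⟨fun _ => ⟨⟨i, hi⟩, ⟨j, hj⟩, ?_, ?_, ?_⟩, fun _ _ _ _ _ => ?_⟩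
    · simp [block, run, Expr.eval, hui]
    · simp [block, run, Expr.eval, huj]
    · exact ⟨hc.1, hc.2.1, hc.2.2.1, hc.2.2.2.1, _, hc.2.2.2.2⟩
    · simp [block, run, Expr.eval]
  · rw [run_guarded_neg (mt hif.1 hc)]
    refine ⟨hus, fun x w z hx hc' => huc x w z ?_ hc'⟩
    by_contra hlt
    have h1 : x = ⟨i, hi⟩ := Fin.ext (by simp only; omega)
    have h2 : w = ⟨j, hj⟩ := Fin.ext (by simp only; omega)
    have h3 : z = ⟨k, hk⟩ := Fin.ext (by simp only; omega)
    exact hc (h1 ▸ h2 ▸ h3 ▸ hc')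

theorem insertVertex_spec {s : Store} {x₀ v x w : Fin n} {B F F' : List (Fin n)}
    {nxt : Fin n → Fin n} (h : HasCycle x₀ B F nxt v s) (h9 : s.var 9 ≠ 0) (hx : s.var 10 = x)
    (hw : s.var 11 = w) (hF : F'.Perm (w :: F)) :
    HasCycle x₀ B F' (Function.update (Function.update nxt w (nxt x)) x w) w
      (insertVertex.run s) := by
  rw [insertVertex, run_guarded_pos (by simpa [Expr.eval] using h9)]
  refine ⟨?_, ?_, ?_, fun u => ?_, fun u => ?_, fun u => ?_⟩
  · simpa [block, run] using h.first
  · simpa [block, run] using h.length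
  · simp [block, run, Expr.eval, hw]
  · have := h.used u
    simp only [List.mem_append, hF.mem_iff, List.mem_cons, or_assoc] at this ⊢
    rw [← this]
    by_cases hu : u = w
    · simp [block, run, Expr.eval, hw, hu]
    · have hu' : (u : ℕ) ≠ w := fun e => hu (Fin.ext e)
      simp [block, run, Expr.eval, hw, hu, hu']
  · have := h.forward u
    simp only [hF.mem_iff, List.mem_cons]
    rw [← this]
    by_cases hu : u = w
    · simp [block, run, Expr.eval, hw, hu]
    · have hu' : (u : ℕ) ≠ w := fun e => hu (Fin.ext e)
      simp [block, run, Expr.eval, hw, hu, hu']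
  · simp only [Function.update_apply]
    by_cases hux : u = x
    · simp [block, run, Expr.eval, hx, hw, hux]
    · have hux' : (u : ℕ) ≠ x := fun e => hux (Fin.ext e)
      by_cases hu : u = w
      · subst hu
        simp [block, run, Expr.eval, hx, hw, hux, hux', h.succ]
      · have hu' : (u : ℕ) ≠ w := fun e => hu (Fin.ext e)
        simp [block, run, Expr.eval, hx, hw, hux, hux', hu, hu', h.succ]

/-- The partial cycle is maintained unconditionally, and completeness is claimed only for a feasible
start: the program runs without knowing whether `U(D)` is 2-connected. -/
theorem extendCycle_spec {s : Store} (hD : D.IsLocallySemicomplete) (hG : HasGraph D s)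
    {x₀ xd v : Fin n} {B F T : List (Fin n)} {nxt : Fin n → Fin n} (hB : D.IsGreedyPath x₀ B)
    (hT : B ++ [x₀] = xd :: T) (hlast : ∀ u, D.Reach u xd) (h : D.IsPartialCycle x₀ B F nxt v)
    (hC : HasCycle x₀ B F nxt v s) :
    ∃ F' nxt' v', D.IsPartialCycle x₀ B F' nxt' v' ∧
      HasCycle x₀ B F' nxt' v' (extendCycle.run s) ∧
      (D.HasArcOrEar B F nxt v → D.HasArcOrEar B F' nxt' v' ∧ ∀ u, u ∈ F' ++ B) := by
  have := run_loop (i := 14) (n := n) (I := fun k t => ∃ F' nxt' v',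
      D.IsPartialCycle x₀ B F' nxt' v' ∧ HasCycle x₀ B F' nxt' v' t ∧
      (D.HasArcOrEar B F nxt v → D.HasArcOrEar B F' nxt' v' ∧
        -- Strict, since `F` is nonempty at the start; hence `n` rounds suffice.
        ((∀ u, u ∈ F' ++ B) ∨ k < F'.length))) s hG.bound
    (p := block [closure 3, search, insertVertex]) ?_ ?_
  · obtain ⟨F', nxt', v', h1, h2, h3⟩ := this
    refine ⟨F', nxt', v', h1, h2, fun he => ⟨(h3 he).1, (h3 he).2.resolve_right fun hn => ?_⟩⟩
    have := h1.nodup.length_le_card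
    simp only [List.length_append, Fintype.card_fin] at this
    omega
  · exact ⟨F, nxt, v, h, hC.congr rfl rfl rfl rfl rfl rfl, fun he =>
      ⟨he, .inr (List.length_pos_of_mem h.mem)⟩⟩
  · rintro k hk t - htv hta ⟨F', nxt', v', h1, h2, h3⟩
    have hG1 : HasGraph D t := hG.congr (htv 0 (by decide)) (hta 0 (by decide))
    have hreach := closure_spec (o := 3) (by simp) (by simp) hG1.bound hG1.adj hG1.le_one
      (U := {u | u ∈ F' ++ B}) h2.used
    have hG2 : HasGraph D ((closure 3).run t) := hG1.run (by decide) (by decide)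
    have h2' : HasCycle x₀ B F' nxt' v' ((closure 3).run t) :=
      h2.congr (run_var (by decide) t) (run_var (by decide) t) (run_var (by decide) t)
        (run_arr (by decide) t) (run_arr (by decide) t) (run_arr (by decide) t)
    have hs := search_spec hG2 h2' hreach
    have h2'' : HasCycle x₀ B F' nxt' v' (search.run ((closure 3).run t)) :=
      h2'.congr (run_var (by decide) _) (run_var (by decide) _) (run_var (by decide) _)
        (run_arr (by decide) _) (run_arr (by decide) _) (run_arr (by decide) _)
    have hrun : (block [closure 3, search, insertVertex]).run t =
      insertVertex.run (search.run ((closure 3).run t)) := rfl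
    rw [hrun]
    by_cases h9 : (search.run ((closure 3).run t)).var 9 = 0
    · refine ⟨F', nxt', v', h1, ?_, fun he => ?_⟩
      · rw [insertVertex, run_guarded_neg (by simpa [Expr.eval] using h9)]
        exact h2''.congr rfl rfl rfl rfl rfl rfl
      · obtain ⟨he', hk'⟩ := h3 he
        refine ⟨he', .inl fun u => ?_⟩
        by_contra hu
        exact hs.2 h9 (h1.exists_canInsert hD hB hT hlast he' hu)
    · obtain ⟨x, w, hx, hw, hi⟩ := hs.1 h9
      obtain ⟨F'', hp, h4, h5⟩ := h1.insert_canInsert hi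
      refine ⟨F'', _, w, h4, (insertVertex_spec h2'' h9 hx hw hp).congr rfl rfl rfl rfl rfl rfl,
        fun he => ⟨h5, ?_⟩⟩
      rcases (h3 he).2 with hall | hlt
      · exact absurd (hall w) hi.2.2.1
      · right
        rw [hp.length_eq, List.length_cons]
        omega

theorem checkCycle_spec {s : Store} (hG : HasGraph D s) {x₀ v : Fin n} {B F : List (Fin n)}
    {nxt : Fin n → Fin n} (hC : HasCycle x₀ B F nxt v s) :
    ((∀ u, u ∈ F ++ B) ∧ D.Adj v (nxt v) ∧ (checkCycle.run s).var 12 = 1) ∨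
      ¬ ((∀ u, u ∈ F ++ B) ∧ D.Adj v (nxt v)) ∧ (checkCycle.run s).var 12 = 0 := by
  classical
  have := run_loop (i := 1) (n := n) (I := fun k t => t.var 12 =
      if (∀ u : Fin n, (u : ℕ) < k → u ∈ F ++ B) ∧ D.Adj v (nxt v) then 1 else 0)
    ((ForProg.assign 12 (get 0 (var 8) (get 5 (var 8) (lit 0)))).run s) hG.bound
    (p := guarded [eq (get 4 (var 1) (lit 0)) (lit 0)] (ForProg.assign 12 (lit 0))) ?_ ?_
  · have hrun : (checkCycle.run s).var 12 =
        if (∀ u : Fin n, (u : ℕ) < n → u ∈ F ++ B) ∧ D.Adj v (nxt v) then 1 else 0 := this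
    rw [hrun]
    simp only [Fin.is_lt, true_imp_iff]
    split_ifs with hc
    exacts [.inl ⟨hc.1, hc.2, rfl⟩, .inr ⟨hc, rfl⟩]
  · have h1 := hG.adj v (nxt v)
    have h2 := hG.le_one v (nxt v)
    simp only [Nat.not_lt_zero, false_imp_iff, implies_true, true_and]
    simp only [run, Expr.eval, hC.open_at, hC.succ]
    rw [← h1]
    simp
    split_ifs <;> omega
  · intro k hk t htk htv hta hI
    have h4 := hta 4 (by decide)
    have hif : (∀ e ∈ [eq (get 4 (var 1) (lit 0)) (lit 0)], e.eval t ≠ 0) ↔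
        (⟨k, hk⟩ : Fin n) ∉ F ++ B := by
      rw [← hC.used ⟨k, hk⟩]
      simp [Expr.eval, htk, h4, run]
    by_cases hkm : (⟨k, hk⟩ : Fin n) ∈ F ++ B
    · rw [run_guarded_neg (fun h => hif.1 h hkm)]
      have : (∀ u : Fin n, (u : ℕ) < k + 1 → u ∈ F ++ B) ↔
          ∀ u : Fin n, (u : ℕ) < k → u ∈ F ++ B := by
        refine ⟨fun h u hu => h u (by omega), fun h u hu => ?_⟩
        rcases Nat.lt_succ_iff_lt_or_eq.1 hu with hu | rfl
        exacts [h u hu, hkm]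
      rw [if_congr (and_congr_left' this) rfl rfl]
      simpa using hI
    · rw [run_guarded_pos (hif.2 hkm), if_neg fun h => hkm (h.1 ⟨k, hk⟩ (Nat.lt_succ_self k))]
      simp [run, Expr.eval]

theorem output_spec {s : Store} (hG : HasGraph D s) {x₀ v : Fin n} {B F : List (Fin n)}
    {nxt : Fin n → Fin n} (hC : HasCycle x₀ B F nxt v s) (i : Fin n) :
    (output.run s).arr 1 i 0 = (nxt^[i] x₀ : Fin n) ∧
      (output.run s).arr 1 i 1 = if (i : ℕ) < n - B.length then 1 else 0 := by
  have := run_loop (i := 1) (n := n) (I := fun k t => t.var 13 = (nxt^[k] x₀ : Fin n) ∧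
      ∀ i < k, t.arr 1 i 0 = (nxt^[i] x₀ : Fin n) ∧
        t.arr 1 i 1 = if i < n - B.length then 1 else 0)
    ((ForProg.assign 13 (var 4)).run s) hG.bound (p := outputBody) ?_ ?_
  · exact this.2 i i.2
  · exact ⟨by simp [run, Expr.eval, hC.first], fun i hi => absurd hi (by omega)⟩
  · rintro k hk t htk htv hta ⟨h1, h2⟩
    have hv0 : t.var 0 = n := (htv 0 (by decide)).trans hG.bound
    have hv6 : t.var 6 = B.length := (htv 6 (by decide)).trans hC.length
    have ha5 : ∀ u : Fin n, t.arr 5 u 0 = nxt u := by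
      rw [hta 5 (by decide)]
      exact hC.succ
    refine ⟨?_, fun i hi => ?_⟩
    · simp only [outputBody, block, run, Expr.eval, Store.setVar_var, Store.setArr_var,
        Store.setArr_arr, h1, Function.iterate_succ_apply']
      simp [ha5]
    · rcases Nat.lt_succ_iff_lt_or_eq.1 hi with hi | rfl
      · have hik : i ≠ k := by omega
        simpa [outputBody, block, run, Expr.eval, htk, hik] using h2 i hi
      · simp [outputBody, block, run, Expr.eval, htk, h1, hv0, hv6]

theorem hamiltonProg_spec (hn : 3 ≤ n) (hc : D.IsConnected) (hD : D.IsLocallySemicomplete) :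
    (∃ R : D.HamiltonOrientedCycle n, Displays (hamiltonProg.run (input D)) R ∧
        ∀ R' : D.HamiltonOrientedCycle n, R'.sigmaMax ≤ R.sigmaPlus) ∨
      (IsEmpty (D.HamiltonOrientedCycle n) ∧ (hamiltonProg.run (input D)).var 0 = 0) := by
  set s₁ := (closure 2).run (input D) with hs₁
  set s₂ := findFirst.run s₁ with hs₂
  set s₃ := greedyPath.run s₂ with hs₃
  set s₄ := startCycle.run s₃ with hs₄
  set s₅ := extendCycle.run s₄ with hs₅
  set s₆ := checkCycle.run s₅ with hs₆
  set s₇ := output.run s₆ with hs₇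
  have hrun : hamiltonProg.run (input D) = s₇.setVar 0 (s₇.var 12) := rfl
  have hz : ∀ a, a ≠ 0 → ∀ u : Fin n, (input D).arr a u 0 = 0 := fun a ha u => by
    simp [input, ha]
  have hG₁ : HasGraph D s₁ := hasGraph_input.run (by decide) (by decide)
  have hR₁ : HasReach D s₁ := closure_two_spec hasGraph_input (hz 4 (by simp))
  obtain ⟨x₀, hx₀, hreach⟩ := findFirst_spec (by omega) hD hc hG₁ hR₁
  have hG₂ : HasGraph D s₂ := hG₁.run (by decide) (by decide)
  have hz₂ : ∀ a, a ≠ 0 → a ≠ 2 → ∀ u : Fin n, s₂.arr a u 0 = 0 := fun a h0 h2 u => by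
    rw [hs₂, run_arr (by simp [findFirst, guarded, stores]), hs₁,
      run_arr (by simp [closure, closureInit, closureLoop, guarded, stores, h2])]
    exact hz a h0 u
  have hR₂ : HasReach D s₂ := by
    intro u v
    rw [hs₂, run_arr (by decide)]
    exact hR₁ u v
  obtain ⟨xd, B, T, nxt, hB, hT, hlast, hP⟩ := greedyPath_spec hD hc hG₂ hR₂ hreach hx₀
    (hz₂ 4 (by simp) (by simp)) (hz₂ 5 (by simp) (by simp))
  have hG₃ : HasGraph D s₃ := hG₂.run (by decide) (by decide)
  obtain ⟨hI, hC⟩ := startCycle_spec hP hB hT (fun u => by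
    rw [run_arr (by decide)]
    exact hz₂ 6 (by simp) (by simp) u)
  have hG₄ : HasGraph D s₄ := hG₃.run (by decide) (by decide)
  obtain ⟨F', nxt', v', hI', hC', hfull⟩ := extendCycle_spec hD hG₄ hB hT hlast hI hC
  have hG₅ : HasGraph D s₅ := hG₄.run (by decide) (by decide)
  have hG₆ : HasGraph D s₆ := hG₅.run (by decide) (by decide)
  have hC₆ : HasCycle x₀ B F' nxt' v' s₆ :=
    hC'.congr (run_var (by decide) _) (run_var (by decide) _) (run_var (by decide) _)
      (run_arr (by decide) _) (run_arr (by decide) _) (run_arr (by decide) _)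
  have hout := output_spec hG₆ hC₆
  have h12 : s₇.var 12 = s₆.var 12 := run_var (by decide) _
  rw [hrun]
  rcases checkCycle_spec hG₅ hC' with ⟨hall, hadj, h1⟩ | ⟨hno, h0⟩
  · left
    obtain ⟨R, hR, hR'⟩ := hI'.exists_hamiltonOrientedCycle (Fintype.card_fin n) hB hall hadj
    refine ⟨R, ⟨?_, fun i => ⟨?_, ?_⟩⟩, fun R' => hR ▸ R'.sigmaMax_le hD hB⟩
    · simpa [h12] using h1
    · rw [Store.setVar_arr, (hR' i).1]
      exact (hout i).1
    · rw [Store.setVar_arr, (hout i).2]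
      simp only [(hR' i).2]
  · right
    refine ⟨⟨fun R => hno ?_⟩, by simpa [h12] using h0⟩
    -- A Hamilton oriented cycle would make the start feasible, and then the final check would not
    -- have failed.
    have h2 := R.underlying_isTwoConnected hn (by simp) hc
    obtain ⟨he, hall⟩ := hfull (hasArcOrEar_start (by simpa using hn) hD hc (.inr h2) hB hT hlast
      (by simp))
    refine ⟨hall, he.resolve_right ?_⟩
    rintro ⟨w, hw⟩
    exact hw.1 (hall w)

end RAM

theorem theorem1p9 :
    (∀ (V : Type*) [Fintype V] (n : ℕ) (D : Digraph V), Fintype.card V = n → 3 ≤ n →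
      D.IsLoopless → D.IsConnected → D.IsLocallySemicomplete →
        (¬ D.IsStrong → D.underlying.IsTwoConnected →
          ∀ (l : ℕ) (C : Fin (l + 1) → Set V), D.IsAcyclicOrdering C →
            ∃ d : ℕ, D.IsSetDist (C 0) (C (Fin.last l)) d ∧ d ≤ n ∧ D.IsMaxSigma n (n - d)) ∧
        (¬ D.IsStrong → ¬ D.underlying.IsTwoConnected → IsEmpty (D.HamiltonOrientedCycle n)) ∧
        (D.IsStrong → D.IsMaxSigma n n)) ∧
    -- one program that works for all digraphs of the class, in time polynomial in `n`
    (∃ (p : RAM.Prog) (q : Polynomial ℕ), ∀ (n : ℕ) (D : Digraph (Fin n)), 3 ≤ n →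
      D.IsLoopless → D.IsConnected → D.IsLocallySemicomplete →
        ∃ s : RAM.Store, RAM.HaltsWithin p (RAM.input D) (q.eval n) s ∧
          ((∃ R : D.HamiltonOrientedCycle n, RAM.Displays s R ∧
              ∀ R' : D.HamiltonOrientedCycle n, R'.sigmaMax ≤ R.sigmaPlus) ∨
            (IsEmpty (D.HamiltonOrientedCycle n) ∧ s.var 0 = 0))) :=
  ⟨fun _ _ _ _ hV hn _ hc hD => Digraph.isMaxSigma_trichotomy hV hn hc hD,
    RAM.hamiltonProg.compile, RAM.hamiltonProg.cost, fun _ D hn _ hc hD =>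
      ⟨RAM.hamiltonProg.run (RAM.input D), RAM.ForProg.haltsWithin RAM.hamiltonProg_wellFormed _,
        RAM.hamiltonProg_spec hn hc hD⟩⟩
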